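/- Let $R=\mathbb C[x_1,x_2,x_3,x_4]$ and let $(\mathbb C^*)^4$ act on $\mathbb C^4$ by scaling the coordinates. For a coherent sheaf $E$ let $T_i(E)\subset E$ be its maximal subsheaf of dimension $\le i$. For $1\le a<b\le 4$ and a finite partition $\lambda_{ab}\subset\mathbb Z_{\ge 0}^2$ (a finite set closed under decreasing coordinates), let $Z_{\lambda_{ab}}\subset\mathbb C^4$ be the subscheme whose ideal is generated by the monomials $x_1^{i_1}x_2^{i_2}x_3^{i_3}x_4^{i_4}$ with $(i_a,i_b)\notin\lambda_{ab}$; it is empty if $\lambda_{ab}=\varnothing$, and otherwise a thickening of the coordinate plane $x_a=x_b=0$. Let $Z\subset\mathbb C^4$ be a $(\mathbb C^*)^4$-fixed closed subscheme of dimension $2$ with $T_0(\mathcal O_Z)=0$. Let $\mathfrak m\subset\mathcal O_Z$ be the ideal of the origin and let $Z_1\subset Z$ be the closed subscheme with $\mathcal O_{Z_1}=\mathcal O_Z/T_1(\mathcal O_Z)$. There are unique finite partitions $\lambda_{ab}$, $1\le a<b\le 4$, such that $Z_1=\bigcup_{a<b}Z_{\lambda_{ab}}$ scheme-theoretically. Put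 $$A=Z_{\lambda_{12}}\cup Z_{\lambda_{13}}\cup Z_{\lambda_{23}},\qquad B=Z_{\lambda_{14}}\cup Z_{\lambda_{24}}\cup Z_{\lambda_{34}},\qquad W=A\cap B.$$ (1) The induced sequence $$0\to\varinjlim_r\mathcal Hom(\mathfrak m^r,T_1(\mathcal O_Z))\to\varinjlim_r\mathcal Hom(\mathfrak m^r,\mathcal O_Z)\to\varinjlim_r\mathcal Hom(\mathfrak m^r,\mathcal O_{Z_1})\to 0$$ is exact, the canonical map $\mathcal O_{Z_1}\to\varinjlim_r\mathcal Hom(\mathfrak m^r,\mathcal O_{Z_1})$ is injective, and there is a $(\mathbb C^*)^4$-equivariant isomorphism $$\varinjlim_r\mathcal Hom(\mathfrak m^r,\mathcal O_{Z_1})/\mathcal O_{Z_1}\cong T_0(\mathcal O_W).$$ (2) A $\mathrm{PT}_0$ pair on $\mathbb C^4$ is a coherent sheaf $F$ with $2$-dimensional (not necessarily proper) support together with a section $s$ such that $T_0(F)=0$ and $\operatorname{coker}(s:\mathcal O\to F)$ is zero or $0$-dimensional; it is $(\mathbb C^*)^4$-fixed if it is isomorphic, as a pair, to each of its translates by the torus.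 Suppose that $Z$ is pure, i.e. $T_1(\mathcal O_Z)=0$. Then the isomorphism classes of $(\mathbb C^*)^4$-fixed $\mathrm{PT}_0$ pairs on $\mathbb C^4$ with scheme-theoretic support $Z$ are in bijection with the closed points of $$\bigsqcup_{m\ge 0}\mathrm{Quot}_W(T_0(\mathcal O_W),m)^{(\mathbb C^*)^4},$$ the fixed points of the Quot schemes of length $m$ quotients of $T_0(\mathcal O_W)$, and these are finite in number. More precisely, a fixed quotient of $T_0(\mathcal O_W)$ with kernel $Q$ corresponds to the pair $(F,s)$, where $F\subset\mathcal O_A\oplus\mathcal O_B$ is the preimage of $Q$ under the difference map $\mathcal O_A\oplus\mathcal O_B\to\mathcal O_W$, and $s=(1,1)$. -/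

import Mathlib

namespace SurfacePairs

/-! ## The torus acting on affine four-space and on its modules

Affine space `ℂ⁴` is given by its coordinate ring, coherent sheaves on it by finitely generated
modules, closed subschemes by ideals. The coordinates `x₁, x₂, x₃, x₄` are `X 0, X 1, X 2, X 3`. -/

/-- The coordinate ring `ℂ[x₁, x₂, x₃, x₄]` of affine four-space. -/
abbrev R4 : Type := MvPolynomial (Fin 4) ℂ

/-- The complex points of the torus `(ℂ*)⁴`. -/
def Torus : Type := Fin 4 → ℂˣ

instance : CommGroup Torus := inferInstanceAs (CommGroup (Fin 4 → ℂˣ))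

/-- Pull-back of functions along `(x₁, …, x₄) ↦ (t₁ x₁, …, t₄ x₄)`. -/
noncomputable def pull (t : Torus) : R4 →ₐ[ℂ] R4 :=
  MvPolynomial.aeval fun i => MvPolynomial.C ((t i : ℂˣ) : ℂ) * MvPolynomial.X i

theorem pull_X (t : Torus) (i : Fin 4) :
    pull t (MvPolynomial.X i) = MvPolynomial.C ((t i : ℂˣ) : ℂ) * MvPolynomial.X i := by
  simp [pull]

theorem pull_one : pull 1 = AlgHom.id ℂ R4 := by
  apply MvPolynomial.algHom_ext
  intro i
  have h : ((1 : Torus) i) = 1 := rfl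
  simp [pull_X, h]

theorem pull_mul (s t : Torus) : pull (s * t) = (pull s).comp (pull t) := by
  apply MvPolynomial.algHom_ext
  intro i
  have h : ((s * t : Torus) i) = s i * t i := rfl
  have hc : pull s (MvPolynomial.C ((t i : ℂˣ) : ℂ)) = MvPolynomial.C ((t i : ℂˣ) : ℂ) :=
    (pull s).commutes _
  rw [AlgHom.comp_apply, pull_X, pull_X, map_mul, hc, pull_X, h]
  push_cast
  rw [MvPolynomial.C_mul]
  ring

noncomputable instance : MulSemiringAction Torus R4 where
  smul t f := pull t f
  one_smul f := by change pull 1 f = f; rw [pull_one]; rfl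
  mul_smul s t f := by change pull (s * t) f = pull s (pull t f); rw [pull_mul]; rfl
  smul_zero t := map_zero (pull t)
  smul_add t := map_add (pull t)
  smul_one t := map_one (pull t)
  smul_mul t := map_mul (pull t)

theorem torus_smul_def (t : Torus) (f : R4) : t • f = pull t f := rfl

/-- A torus-equivariant module over the coordinate ring. -/
class TorusModule (M : Type*) [AddCommGroup M] [Module R4 M] extends
    DistribMulAction Torus M where
  smul_ring_smul : ∀ (t : Torus) (f : R4) (m : M), t • (f • m) = (t • f) • (t • m)

/-- Invariance of a submodule of an equivariant module under the torus. For an ideal this says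
that the closed subscheme that it defines is torus-fixed. -/
class IsTorusFixed {M : Type*} [AddCommGroup M] [Module R4 M] [TorusModule M]
    (N : Submodule R4 M) : Prop where
  smul_mem : ∀ (t : Torus) (m : M), m ∈ N → t • m ∈ N

noncomputable instance : TorusModule R4 where
  smul_ring_smul t f m := smul_mul' t f m

noncomputable instance {M : Type*} [AddCommGroup M] [Module R4 M] [TorusModule M]
    (N : Submodule R4 M) [IsTorusFixed N] : TorusModule N where
  smul t m := ⟨t • (m : M), IsTorusFixed.smul_mem t _ m.2⟩
  one_smul m := Subtype.ext (one_smul Torus (m : M))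
  mul_smul s t m := Subtype.ext (mul_smul s t (m : M))
  smul_zero t := Subtype.ext (smul_zero (A := M) t)
  smul_add t m n := Subtype.ext (smul_add t (m : M) n)
  smul_ring_smul t f m := Subtype.ext (TorusModule.smul_ring_smul t f (m : M))

theorem coe_torus_smul {M : Type*} [AddCommGroup M] [Module R4 M] [TorusModule M]
    (N : Submodule R4 M) [IsTorusFixed N] (t : Torus) (m : N) :
    ((t • m : N) : M) = t • (m : M) := rfl

/-- The additive map by which `t` acts on an equivariant module. -/
def actHom (M : Type*) [AddCommGroup M] [Module R4 M] [TorusModule M] (t : Torus) : M →+ M :=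
  DistribSMul.toAddMonoidHom M t

noncomputable instance {M : Type*} [AddCommGroup M] [Module R4 M] [TorusModule M]
    (N : Submodule R4 M) [IsTorusFixed N] : TorusModule (M ⧸ N) where
  smul t := QuotientAddGroup.map N.toAddSubgroup N.toAddSubgroup (actHom M t)
    (fun m hm => IsTorusFixed.smul_mem t m hm)
  one_smul x := by
    induction x using Submodule.Quotient.induction_on with
    | _ m => exact congrArg (Submodule.Quotient.mk (p := N)) (one_smul Torus m)
  mul_smul s t x := by
    induction x using Submodule.Quotient.induction_on with
    | _ m => exact congrArg (Submodule.Quotient.mk (p := N)) (mul_smul s t m)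
  smul_zero t := map_zero (QuotientAddGroup.map N.toAddSubgroup N.toAddSubgroup (actHom M t) _)
  smul_add t := map_add (QuotientAddGroup.map N.toAddSubgroup N.toAddSubgroup (actHom M t) _)
  smul_ring_smul t f x := by
    induction x using Submodule.Quotient.induction_on with
    | _ m =>
      exact congrArg (Submodule.Quotient.mk (p := N)) (TorusModule.smul_ring_smul t f m)

theorem torus_smul_mk {M : Type*} [AddCommGroup M] [Module R4 M] [TorusModule M]
    (N : Submodule R4 M) [IsTorusFixed N] (t : Torus) (m : M) :
    t • (Submodule.Quotient.mk m : M ⧸ N) = Submodule.Quotient.mk (t • m) := rfl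

noncomputable instance (I : Ideal R4) [IsTorusFixed I] : TorusModule (R4 ⧸ I) :=
  inferInstanceAs (TorusModule (R4 ⧸ (I : Submodule R4 R4)))

/-! ## Torsion subsheaves -/

/-- `T_i(M)`, the maximal submodule of dimension at most `i`: the sum of all finitely generated
submodules whose support has dimension at most `i`. -/
noncomputable def torsion (i : ℕ) (M : Type*) [AddCommGroup M] [Module R4 M] : Submodule R4 M :=
  sSup {N : Submodule R4 M | N.FG ∧ Module.supportDim R4 N ≤ (i : WithBot ℕ∞)}

/-- The translate `t • N` of a submodule. -/
def translate {M : Type*} [AddCommGroup M] [Module R4 M] [TorusModule M] (t : Torus)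
    (N : Submodule R4 M) : Submodule R4 M where
  carrier := {m | t⁻¹ • m ∈ N}
  add_mem' {a b} ha hb := by
    change t⁻¹ • (a + b) ∈ N
    rw [smul_add]
    exact N.add_mem ha hb
  zero_mem' := by
    change t⁻¹ • (0 : M) ∈ N
    rw [smul_zero]
    exact N.zero_mem
  smul_mem' f m hm := by
    change t⁻¹ • (f • m) ∈ N
    rw [TorusModule.smul_ring_smul]
    exact N.smul_mem _ hm

theorem mem_translate {M : Type*} [AddCommGroup M] [Module R4 M] [TorusModule M] {t : Torus}
    {N : Submodule R4 M} {m : M} : m ∈ translate t N ↔ t⁻¹ • m ∈ N := Iff.rfl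

theorem translate_fg {M : Type*} [AddCommGroup M] [Module R4 M] [TorusModule M] (t : Torus)
    {N : Submodule R4 M} (hN : N.FG) : (translate t N).FG := by
  classical
  obtain ⟨S, rfl⟩ := hN
  refine ⟨S.image (fun m : M => t • m), le_antisymm ?_ ?_⟩
  · rw [Submodule.span_le]
    intro m hm
    obtain ⟨n, hn, rfl⟩ := Finset.mem_image.1 (Finset.mem_coe.1 hm)
    change t⁻¹ • (t • n) ∈ Submodule.span R4 (S : Set M)
    rw [inv_smul_smul]
    exact Submodule.subset_span hn
  · intro m hm
    have key : ∀ n ∈ Submodule.span R4 (S : Set M),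
        t • n ∈ Submodule.span R4 ((S.image (fun m : M => t • m) : Finset M) : Set M) := by
      intro n hn
      induction hn using Submodule.span_induction with
      | mem x hx => exact Submodule.subset_span (Finset.mem_coe.2 (Finset.mem_image_of_mem _ hx))
      | zero => rw [smul_zero]; exact Submodule.zero_mem _
      | add x y _ _ hx hy => rw [smul_add]; exact Submodule.add_mem _ hx hy
      | smul f x _ hx =>
        rw [TorusModule.smul_ring_smul]; exact Submodule.smul_mem _ _ hx
    simpa using key _ (mem_translate.1 hm)

theorem annihilator_translate {M : Type*} [AddCommGroup M] [Module R4 M] [TorusModule M]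
    (t : Torus) (N : Submodule R4 M) :
    Module.annihilator R4 (translate t N) =
      (Module.annihilator R4 N).map
        ((MulSemiringAction.toRingEquiv Torus R4 t : R4 ≃+* R4) : R4 →+* R4) := by
  ext f
  change _ ↔ f ∈ Ideal.map (MulSemiringAction.toRingEquiv Torus R4 t) _
  rw [Ideal.mem_map_of_equiv]
  constructor
  · intro h
    refine ⟨t⁻¹ • f, ?_, smul_inv_smul t f⟩
    rw [Module.mem_annihilator] at h ⊢
    intro n
    have hm : t • (n : M) ∈ translate t N := by
      rw [mem_translate, inv_smul_smul]; exact n.2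
    have h1 := congrArg Subtype.val (h ⟨_, hm⟩)
    have h2 : f • (t • (n : M)) = 0 := h1
    apply Subtype.ext
    change (t⁻¹ • f) • (n : M) = 0
    have h3 := congrArg (fun m => t⁻¹ • m) h2
    simpa [TorusModule.smul_ring_smul, inv_smul_smul] using h3
  · rintro ⟨g, hg, rfl⟩
    rw [Module.mem_annihilator] at hg ⊢
    intro n
    have h1 := congrArg Subtype.val (hg ⟨_, mem_translate.1 n.2⟩)
    have h2 : g • (t⁻¹ • (n : M)) = 0 := h1
    apply Subtype.ext
    change (t • g) • (n : M) = 0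
    have h3 := congrArg (fun m => t • m) h2
    simpa [TorusModule.smul_ring_smul, smul_inv_smul] using h3

theorem supportDim_translate {M : Type*} [AddCommGroup M] [Module R4 M] [TorusModule M]
    (t : Torus) {N : Submodule R4 M} (hN : N.FG) :
    Module.supportDim R4 (translate t N) = Module.supportDim R4 N := by
  have : Module.Finite R4 N := Module.Finite.iff_fg.2 hN
  have : Module.Finite R4 (translate t N) := Module.Finite.iff_fg.2 (translate_fg t hN)
  rw [Module.supportDim_eq_ringKrullDim_quotient_annihilator,
    Module.supportDim_eq_ringKrullDim_quotient_annihilator]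
  exact (ringKrullDim_eq_of_ringEquiv
    (Ideal.quotientEquiv _ _ (MulSemiringAction.toRingEquiv Torus R4 t)
      (annihilator_translate t N))).symm

instance (i : ℕ) {M : Type*} [AddCommGroup M] [Module R4 M] [TorusModule M] :
    IsTorusFixed (torsion i M) where
  smul_mem t m hm := by
    have h : torsion i M ≤ translate t⁻¹ (torsion i M) := by
      refine sSup_le fun N hN => ?_
      have h1 : translate t N ≤ torsion i M :=
        le_sSup ⟨translate_fg t hN.1, (supportDim_translate t hN.1).trans_le hN.2⟩
      intro n hn
      rw [mem_translate, inv_inv]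
      apply h1
      rw [mem_translate, inv_smul_smul]
      exact hn
    have h2 := h hm
    rwa [mem_translate, inv_inv] at h2

/-! ## The direct limit of `Hom(𝔪^r, M)` -/

/-- `M` is an `O_Z`-module, where `Z` is the closed subscheme with ideal `I`. -/
class IsModuleOn (I : Ideal R4) (M : Type*) [AddCommGroup M] [Module R4 M] : Prop where
  smul_eq_zero : ∀ f ∈ I, ∀ m : M, f • m = 0

instance (I : Ideal R4) : IsModuleOn I (R4 ⧸ I) where
  smul_eq_zero f hf m := by
    induction m using Submodule.Quotient.induction_on with
    | _ g =>
      rw [← Submodule.Quotient.mk_smul, Submodule.Quotient.mk_eq_zero]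
      exact I.mul_mem_right g hf

instance (I : Ideal R4) (M : Type*) [AddCommGroup M] [Module R4 M] [IsModuleOn I M]
    (N : Submodule R4 M) : IsModuleOn I (M ⧸ N) where
  smul_eq_zero f hf m := by
    induction m using Submodule.Quotient.induction_on with
    | _ g => rw [← Submodule.Quotient.mk_smul, IsModuleOn.smul_eq_zero f hf g]; rfl

/-- The ideal of the origin in the coordinate ring of the closed subscheme with ideal `I`. -/
noncomputable def originIdeal (I : Ideal R4) : Ideal (R4 ⧸ I) :=
  (Ideal.span (Set.range (MvPolynomial.X : Fin 4 → R4))).map (Ideal.Quotient.mk I)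

/-- The power `𝔪^r` of the ideal of the origin, as a submodule of `O_Z`. -/
noncomputable def originPow (I : Ideal R4) (r : ℕ) : Submodule R4 (R4 ⧸ I) :=
  (originIdeal I ^ r).restrictScalars R4

theorem originPow_anti (I : Ideal R4) {r s : ℕ} (h : r ≤ s) : originPow I s ≤ originPow I r :=
  Ideal.pow_le_pow_right h

/-- `Hom(𝔪^r, M)`. -/
abbrev PowHom (I : Ideal R4) (M : Type*) [AddCommGroup M] [Module R4 M] (r : ℕ) : Type _ :=
  originPow I r →ₗ[R4] M

/-- Restriction `Hom(𝔪^r, M) → Hom(𝔪^s, M)` for `r ≤ s`. -/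
noncomputable def powRestrict (I : Ideal R4) (M : Type*) [AddCommGroup M] [Module R4 M]
    (r s : ℕ) (h : r ≤ s) : PowHom I M r →ₗ[R4] PowHom I M s :=
  LinearMap.lcomp R4 M (Submodule.inclusion (originPow_anti I h))

instance (I : Ideal R4) (M : Type*) [AddCommGroup M] [Module R4 M] :
    DirectedSystem (PowHom I M) (powRestrict I M · · ·) where
  map_self _ _ := rfl
  map_map _ _ _ _ _ _ := rfl

/-- The direct limit over `r` of `Hom(𝔪^r, M)`, with `𝔪 ⊂ O_Z` the ideal of the origin and `Z` the
closed subscheme with ideal `I`. -/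
def LimHom (I : Ideal R4) (M : Type*) [AddCommGroup M] [Module R4 M] : Type _ :=
  DirectLimit (PowHom I M) (powRestrict I M)

noncomputable instance (I : Ideal R4) (M : Type*) [AddCommGroup M] [Module R4 M] :
    AddCommGroup (LimHom I M) :=
  inferInstanceAs (AddCommGroup (DirectLimit (PowHom I M) (powRestrict I M)))

noncomputable instance (I : Ideal R4) (M : Type*) [AddCommGroup M] [Module R4 M] :
    Module R4 (LimHom I M) :=
  inferInstanceAs (Module R4 (DirectLimit (PowHom I M) (powRestrict I M)))

namespace LimHom

section

variable (I : Ideal R4) {M N : Type*} [AddCommGroup M] [Module R4 M] [AddCommGroup N]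
  [Module R4 N]

/-- The class in the direct limit of a homomorphism `𝔪^r → M`. -/
noncomputable def of (r : ℕ) : PowHom I M r →ₗ[R4] LimHom I M where
  toFun g := (⟦⟨r, g⟩⟧ : DirectLimit (PowHom I M) (powRestrict I M))
  map_add' g h := (DirectLimit.add_def (f := powRestrict I M) r g h).symm
  map_smul' _ _ := rfl

variable {I}

theorem exists_of (x : LimHom I M) : ∃ r g, x = of I r g :=
  DirectLimit.exists_eq_mk (powRestrict I M) x

theorem of_eq_of {r s : ℕ} (g : PowHom I M r) (h : PowHom I M s) :
    of I r g = of I s h ↔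
      ∃ (k : ℕ) (hr : r ≤ k) (hs : s ≤ k), powRestrict I M r k hr g = powRestrict I M s k hs h :=
  Quotient.eq (r := DirectLimit.setoid (powRestrict I M · · ·))

theorem exists_of₂ (x y : LimHom I M) : ∃ r g h, x = of I r g ∧ y = of I r h :=
  DirectLimit.exists_eq_mk₂ (powRestrict I M) x y

variable (I)

/-- The map of direct limits induced by a homomorphism of modules. -/
noncomputable def map (φ : M →ₗ[R4] N) : LimHom I M →ₗ[R4] LimHom I N where
  toFun := DirectLimit.map (powRestrict I M · · ·) (powRestrict I N · · ·)
    (fun _ g => φ.comp g) (fun _ _ _ _ => rfl)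
  map_add' x y := by
    obtain ⟨r, g, h, rfl, rfl⟩ := exists_of₂ x y
    rw [← map_add]
    have e : φ.comp (g + h) = φ.comp g + φ.comp h := LinearMap.comp_add _ _ _
    exact (congrArg (of I r) e).trans (map_add (of I r) _ _)
  map_smul' f x := by
    obtain ⟨r, g, rfl⟩ := exists_of x
    rw [← map_smul]
    have e : φ.comp (f • g) = f • φ.comp g := LinearMap.comp_smul _ _ _
    exact (congrArg (of I r) e).trans (map_smul (of I r) _ _)

theorem map_of (φ : M →ₗ[R4] N) (r : ℕ) (g : PowHom I M r) :
    map I φ (of I r g) = of I r (φ.comp g) := rfl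

/-- For an element `m` of an `O_Z`-module, the map `O_Z → M` sending `a` to `a • m`. -/
noncomputable def mulBy [IsModuleOn I M] : M →ₗ[R4] ((R4 ⧸ I) →ₗ[R4] M) where
  toFun m := Submodule.liftQ I (LinearMap.toSpanSingleton R4 M m)
    (fun f hf => by simpa using IsModuleOn.smul_eq_zero f hf m)
  map_add' m n := by
    refine LinearMap.ext fun a => ?_
    induction a using Submodule.Quotient.induction_on with
    | _ g => exact smul_add g m n
  map_smul' f m := by
    refine LinearMap.ext fun a => ?_
    induction a using Submodule.Quotient.induction_on with
    | _ g => exact smul_comm g f m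

theorem mulBy_mk [IsModuleOn I M] (m : M) (f : R4) :
    mulBy I m (Submodule.Quotient.mk f) = f • m := rfl

/-- The canonical map from an `O_Z`-module `M` to the direct limit: an element `m` goes to the
class of the homomorphism `O_Z = 𝔪⁰ → M`, `a ↦ a • m`. -/
noncomputable def canonical (M : Type*) [AddCommGroup M] [Module R4 M] [IsModuleOn I M] :
    M →ₗ[R4] LimHom I M :=
  (of I 0).comp ((LinearMap.lcomp R4 M (originPow I 0).subtype).comp (mulBy I))

theorem canonical_apply [IsModuleOn I M] (m : M) :
    canonical I M m = of I 0 ((mulBy I m).comp (originPow I 0).subtype) := rfl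

end

end LimHom

instance (I : Ideal R4) [IsTorusFixed I] (r : ℕ) : IsTorusFixed (originPow I r) where
  smul_mem t a ha := by
    let φ : (R4 ⧸ I) →+* (R4 ⧸ I) :=
      Ideal.quotientMap I (MulSemiringAction.toRingHom Torus R4 t)
        (fun f hf => IsTorusFixed.smul_mem (N := (I : Submodule R4 R4)) t f hf)
    have hφ : ∀ b : R4 ⧸ I, t • b = φ b := by
      intro b
      induction b using Submodule.Quotient.induction_on with
      | _ f => rfl
    have h1 : (originIdeal I).map φ ≤ originIdeal I := by
      rw [originIdeal, Ideal.map_map, Ideal.map_span, Ideal.span_le]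
      rintro _ ⟨_, ⟨i, rfl⟩, rfl⟩
      have e : (φ.comp (Ideal.Quotient.mk I)) (MvPolynomial.X i) =
          Ideal.Quotient.mk I
            (MvPolynomial.C ((t i : ℂˣ) : ℂ) * MvPolynomial.X i) := by
        rw [← pull_X]; rfl
      rw [SetLike.mem_coe, e]
      exact Ideal.mem_map_of_mem _
        (Ideal.mul_mem_left _ _ (Ideal.subset_span ⟨i, rfl⟩))
    have h2 : (originIdeal I ^ r).map φ ≤ originIdeal I ^ r := by
      rw [Ideal.map_pow]
      exact Ideal.pow_right_mono h1 r
    rw [hφ]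
    exact h2 (Ideal.mem_map_of_mem φ ha)

/-- The torus action on `Hom(𝔪^r, M)` by conjugation: `(t • g)(a) = t • g(t⁻¹ • a)`. -/
noncomputable def conj (I : Ideal R4) [IsTorusFixed I] {M : Type*} [AddCommGroup M] [Module R4 M]
    [TorusModule M] (t : Torus) {r : ℕ} (g : PowHom I M r) : PowHom I M r where
  toFun a := t • g (t⁻¹ • a)
  map_add' a b := by rw [smul_add, map_add, smul_add]
  map_smul' f a := by
    rw [TorusModule.smul_ring_smul, map_smul, TorusModule.smul_ring_smul, smul_inv_smul]
    rfl

noncomputable instance (I : Ideal R4) [IsTorusFixed I] (M : Type*) [AddCommGroup M] [Module R4 M]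
    [TorusModule M] : TorusModule (LimHom I M) where
  smul t := DirectLimit.map (powRestrict I M · · ·) (powRestrict I M · · ·)
    (fun _ g => conj I t g) (fun _ _ _ _ => rfl)
  one_smul x := by
    obtain ⟨r, g, rfl⟩ := LimHom.exists_of x
    refine congrArg (LimHom.of I r) (LinearMap.ext fun a => ?_)
    change (1 : Torus) • g ((1 : Torus)⁻¹ • a) = g a
    rw [inv_one, one_smul, one_smul]
  mul_smul s t x := by
    obtain ⟨r, g, rfl⟩ := LimHom.exists_of x
    refine congrArg (LimHom.of I r) (LinearMap.ext fun a => ?_)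
    change (s * t) • g ((s * t)⁻¹ • a) = s • t • g (t⁻¹ • s⁻¹ • a)
    rw [mul_smul, mul_inv_rev, mul_smul]
  smul_zero t := by
    have e : conj I t (0 : PowHom I M 0) = 0 := LinearMap.ext fun a => smul_zero t
    rw [← map_zero (LimHom.of (M := M) I 0)]
    exact congrArg (LimHom.of I 0) e
  smul_add t x y := by
    obtain ⟨r, g, h, rfl, rfl⟩ := LimHom.exists_of₂ x y
    have e : conj I t (g + h) = conj I t g + conj I t h :=
      LinearMap.ext fun a => smul_add t _ _
    rw [← map_add]
    exact (congrArg (LimHom.of I r) e).trans (map_add (LimHom.of I r) _ _)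
  smul_ring_smul t f x := by
    obtain ⟨r, g, rfl⟩ := LimHom.exists_of x
    have e : conj I t (f • g) = (t • f) • conj I t g :=
      LinearMap.ext fun a => TorusModule.smul_ring_smul t f _
    rw [← map_smul]
    exact (congrArg (LimHom.of I r) e).trans (map_smul (LimHom.of I r) _ _)

theorem torus_smul_of (I : Ideal R4) [IsTorusFixed I] {M : Type*} [AddCommGroup M] [Module R4 M]
    [TorusModule M] (t : Torus) (r : ℕ) (g : PowHom I M r) :
    t • LimHom.of I r g = LimHom.of I r (conj I t g) := rfl

theorem torus_smul_canonical (I : Ideal R4) [IsTorusFixed I] {M : Type*} [AddCommGroup M]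
    [Module R4 M] [TorusModule M] [IsModuleOn I M] (t : Torus) (m : M) :
    t • LimHom.canonical I M m = LimHom.canonical I M (t • m) := by
  rw [LimHom.canonical_apply, LimHom.canonical_apply, torus_smul_of]
  refine congrArg (LimHom.of I 0) (LinearMap.ext fun a => ?_)
  obtain ⟨a, ha⟩ := a
  induction a using Submodule.Quotient.induction_on with
  | _ f =>
    change t • LimHom.mulBy I m (Submodule.Quotient.mk (t⁻¹ • f)) =
      LimHom.mulBy I (t • m) (Submodule.Quotient.mk f)
    rw [LimHom.mulBy_mk, LimHom.mulBy_mk, TorusModule.smul_ring_smul, smul_inv_smul]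

instance (I : Ideal R4) [IsTorusFixed I] {M : Type*} [AddCommGroup M]
    [Module R4 M] [TorusModule M] [IsModuleOn I M] :
    IsTorusFixed (LinearMap.range (LimHom.canonical I M)) where
  smul_mem t x hx := by
    obtain ⟨m, rfl⟩ := hx
    exact ⟨t • m, (torus_smul_canonical I t m).symm⟩

/-! ## Subschemes made of thickened coordinate planes -/

/-- Pairs `a < b` of coordinate indices. -/
abbrev CoordPair : Type := {p : Fin 4 × Fin 4 // p.1 < p.2}

/-- Finite partitions: finite subsets of `ℕ²` closed under decreasing coordinates. -/
def IsFinitePartition (S : Set (ℕ × ℕ)) : Prop := S.Finite ∧ IsLowerSet S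

/-- The ideal of `Z_{λ_ab}`, the thickening of the coordinate plane `x_a = x_b = 0` whose structure
sheaf has as basis the monomials with exponents `(i_a, i_b) ∈ λ_ab`. It is empty if `λ_ab` is. -/
noncomputable def planeIdeal (p : CoordPair) (S : Set (ℕ × ℕ)) : Ideal R4 :=
  Ideal.span ((fun v : Fin 4 →₀ ℕ => MvPolynomial.monomial v (1 : ℂ)) ''
    {v | (v p.1.1, v p.1.2) ∉ S})

/-- The ideal of the scheme-theoretic union of the `Z_{λ_ab}` with `(a, b)` in `P`. -/
noncomputable def unionIdeal (P : Set CoordPair) (lam : CoordPair → Set (ℕ × ℕ)) : Ideal R4 :=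
  ⨅ p ∈ P, planeIdeal p (lam p)

/-- The pairs `(1,2), (1,3), (2,3)`. -/
def pairsA : Set CoordPair := {p | p.1.2 ≠ 3}

/-- The pairs `(1,4), (2,4), (3,4)`. -/
def pairsB : Set CoordPair := {p | p.1.2 = 3}

/-- The ideal of the scheme-theoretic intersection `W` of
`Z_{λ₁₂} ∪ Z_{λ₁₃} ∪ Z_{λ₂₃}` and `Z_{λ₁₄} ∪ Z_{λ₂₄} ∪ Z_{λ₃₄}`. -/
noncomputable abbrev idealW (lam : CoordPair → Set (ℕ × ℕ)) : Ideal R4 :=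
  unionIdeal pairsA lam ⊔ unionIdeal pairsB lam

theorem torus_smul_monomial (t : Torus) (v : Fin 4 →₀ ℕ) :
    t • (MvPolynomial.monomial v (1 : ℂ) : R4) =
      MvPolynomial.C (∏ i, ((t i : ℂˣ) : ℂ) ^ v i) * MvPolynomial.monomial v 1 := by
  rw [torus_smul_def, pull, MvPolynomial.aeval_monomial, MvPolynomial.monomial_eq,
    Finsupp.prod_fintype _ _ (fun _ => pow_zero _), Finsupp.prod_fintype _ _ (fun _ => pow_zero _)]
  simp [mul_pow, Finset.prod_mul_distrib]

instance (p : CoordPair) (S : Set (ℕ × ℕ)) : IsTorusFixed (planeIdeal p S) where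
  smul_mem t f hf := by
    have h : planeIdeal p S ≤
        (planeIdeal p S).comap (MulSemiringAction.toRingHom Torus R4 t) := by
      refine Ideal.span_le.2 ?_
      rintro _ ⟨v, hv, rfl⟩
      change t • (MvPolynomial.monomial v (1 : ℂ) : R4) ∈ planeIdeal p S
      rw [torus_smul_monomial]
      exact Ideal.mul_mem_left _ _ (Ideal.subset_span ⟨v, hv, rfl⟩)
    exact h hf

instance (P : Set CoordPair) (lam : CoordPair → Set (ℕ × ℕ)) :
    IsTorusFixed (unionIdeal P lam) where
  smul_mem t f hf := by
    rw [unionIdeal, Submodule.mem_iInf] at hf ⊢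
    intro p
    have h := hf p
    rw [Submodule.mem_iInf] at h ⊢
    exact fun hp => IsTorusFixed.smul_mem t f (h hp)

instance (lam : CoordPair → Set (ℕ × ℕ)) : IsTorusFixed (idealW lam) where
  smul_mem t f hf := by
    obtain ⟨a, ha, b, hb, rfl⟩ := Submodule.mem_sup.1 hf
    rw [smul_add]
    exact Submodule.add_mem_sup (IsTorusFixed.smul_mem t a ha) (IsTorusFixed.smul_mem t b hb)

/-- The structure sheaf `O_{Z₁} = O_Z / T_1(O_Z)` of the pure part `Z₁` of the closed subscheme `Z`
with ideal `I`. -/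
abbrev PureSheaf (I : Ideal R4) : Type := (R4 ⧸ I) ⧸ torsion 1 (R4 ⧸ I)

/-- The quotient of the direct limit of `Hom(𝔪^r, M)` by the image of `M`. -/
abbrev LimQuot (I : Ideal R4) (M : Type*) [AddCommGroup M] [Module R4 M] [IsModuleOn I M] :
    Type _ :=
  LimHom I M ⧸ LinearMap.range (LimHom.canonical I M)

/-- There is a torus-equivariant isomorphism of modules over the coordinate ring. -/
def EquivariantlyIso (M N : Type*) [AddCommGroup M] [Module R4 M] [TorusModule M]
    [AddCommGroup N] [Module R4 N] [TorusModule N] : Prop :=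
  ∃ e : M ≃ₗ[R4] N, ∀ (t : Torus) (m : M), e (t • m) = t • e m

/-- The ideal of `Z₁ ⊂ Z`, the closed subscheme with structure sheaf `O_Z / T_1(O_Z)`,
where `Z` has ideal `I`. -/
noncomputable def pureIdeal (I : Ideal R4) : Ideal R4 :=
  (torsion 1 (R4 ⧸ I)).comap (Submodule.mkQ I)

/-- The `λ_ab` are finite partitions and `Z₁` is the union of the `Z_{λ_ab}`, `Z` being the
closed subscheme with ideal `I`. -/
def IsPureData (I : Ideal R4) (lam : CoordPair → Set (ℕ × ℕ)) : Prop :=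
  (∀ p, IsFinitePartition (lam p)) ∧ pureIdeal I = unionIdeal Set.univ lam

/-! ## `PT₀` pairs -/

/-- A pair: a module `F` over the coordinate ring with an element `s`, i.e. a quasi-coherent sheaf
on `ℂ⁴` with a global section. -/
structure SheafPair : Type 1 where
  F : Type
  [addCommGroup : AddCommGroup F]
  [module : Module R4 F]
  s : F

attribute [instance] SheafPair.addCommGroup SheafPair.module

namespace SheafPair

/-- Isomorphisms of pairs are isomorphisms of sheaves that match the sections. -/
def Iso (p q : SheafPair) : Prop := ∃ e : p.F ≃ₗ[R4] q.F, e p.s = q.s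

/-- `PT₀` stability: `F` is coherent with 2-dimensional support, without non-zero 0-dimensional
subsheaf, and the cokernel of the section `O → F`, `f ↦ f • s`, has dimension at most 0. -/
def IsPT0 (p : SheafPair) : Prop :=
  Module.Finite R4 p.F ∧ Module.supportDim R4 p.F = 2 ∧ torsion 0 p.F = ⊥ ∧
    Module.supportDim R4 (p.F ⧸ Submodule.span R4 {p.s}) ≤ 0

/-- The pair is torus-fixed up to isomorphism: for every `t` there is an isomorphism of pairs from
`(F, s)` to its translate by `t`, that is, a `t`-semilinear bijection of `F` that fixes `s`. -/
def IsFixed (p : SheafPair) : Prop :=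
  ∀ t : Torus, ∃ σ : p.F ≃+ p.F, (∀ (f : R4) (m : p.F), σ (f • m) = (t • f) • σ m) ∧ σ p.s = p.s

/-- Torus-fixed `PT₀` pairs with scheme-theoretic support the closed subscheme with ideal `I`. -/
def IsFixedPT0On (I : Ideal R4) (p : SheafPair) : Prop :=
  p.IsPT0 ∧ p.IsFixed ∧ Module.annihilator R4 p.F = I

end SheafPair

/-- Isomorphism of torus-fixed `PT₀` pairs with support given by `I`. -/
def fixedPT0Setoid (I : Ideal R4) : Setoid {p : SheafPair // p.IsFixedPT0On I} where
  r p q := p.1.Iso q.1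
  iseqv :=
    { refl := fun _ => ⟨LinearEquiv.refl _ _, rfl⟩
      symm := by
        rintro _ _ ⟨e, he⟩
        exact ⟨e.symm, by rw [← he, e.symm_apply_apply]⟩
      trans := by
        rintro _ _ _ ⟨e, he⟩ ⟨e', he'⟩
        exact ⟨e.trans e', by rw [LinearEquiv.trans_apply, he, he']⟩ }

/-- Isomorphism classes of torus-fixed `PT₀` pairs on `ℂ⁴` with scheme-theoretic support the closed
subscheme with ideal `I`. -/
def FixedPT0 (I : Ideal R4) : Type 1 := Quotient (fixedPT0Setoid I)

/-- The isomorphism class of a torus-fixed `PT₀` pair. -/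
def FixedPT0.mk {I : Ideal R4} (p : SheafPair) (h : p.IsFixedPT0On I) : FixedPT0 I :=
  Quotient.mk (fixedPT0Setoid I) ⟨p, h⟩

/-- The torus-fixed closed points of the Quot scheme of length `m` quotients `E → ζ`, given by the
kernels of the quotients. -/
def FixedQuot (E : Type*) [AddCommGroup E] [Module R4 E] [TorusModule E] (m : ℕ) : Type _ :=
  {K : Submodule R4 E // IsTorusFixed K ∧ Module.length R4 (E ⧸ K) = (m : ℕ∞)}

/-- The kernel of a torus-fixed quotient. -/
def FixedQuot.kernel {E : Type*} [AddCommGroup E] [Module R4 E] [TorusModule E] {m : ℕ}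
    (q : FixedQuot E m) : Submodule R4 E := q.1

/-- The difference map `O_A ⊕ O_B → O_{A ∩ B}`, `(f, g) ↦ f - g`. -/
noncomputable def differenceMap (J K : Ideal R4) : ((R4 ⧸ J) × (R4 ⧸ K)) →ₗ[R4] (R4 ⧸ (J ⊔ K)) :=
  (Submodule.factor (le_sup_left : J ≤ J ⊔ K)).comp (LinearMap.fst R4 _ _) -
    (Submodule.factor (le_sup_right : K ≤ J ⊔ K)).comp (LinearMap.snd R4 _ _)

theorem differenceMap_one (J K : Ideal R4) : differenceMap J K (1, 1) = 0 := by
  have h : differenceMap J K (1, 1) =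
      Ideal.Quotient.mk (J ⊔ K) 1 - Ideal.Quotient.mk (J ⊔ K) 1 := rfl
  rw [h, sub_self]

/-- `T_0(O_W)`. -/
abbrev TorsionW (lam : CoordPair → Set (ℕ × ℕ)) : Type :=
  torsion 0 (R4 ⧸ idealW lam)

/-- For a submodule `Q` of `T_0(O_W)`, the pair `(F, s)` where `F` is the preimage of `Q` under
`O_A ⊕ O_B → O_W` and `s = (1, 1)`; here `A = Z_{λ₁₂} ∪ Z_{λ₁₃} ∪ Z_{λ₂₃}` and
`B = Z_{λ₁₄} ∪ Z_{λ₂₄} ∪ Z_{λ₃₄}`. -/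
noncomputable def pairOf (lam : CoordPair → Set (ℕ × ℕ))
    (Q : Submodule R4 (TorsionW lam)) : SheafPair where
  F := (Q.map (torsion 0 (R4 ⧸ idealW lam)).subtype).comap
    (differenceMap (unionIdeal pairsA lam) (unionIdeal pairsB lam))
  s := ⟨(1, 1), by
    have h := differenceMap_one (unionIdeal pairsA lam) (unionIdeal pairsB lam)
    exact Submodule.mem_comap.2 (h ▸ Submodule.zero_mem _)⟩

end SurfacePairs

/-!
A coherent sheaf on affine space is a finitely generated module, and `lim Hom(𝔪^r, M)` is the
module of sections of `M` over the punctured affine space. Two principles carry the proof.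

*Torus-fixed ideals are monomial* (`isMonomialIdeal_of_torusFixed`). A monomial ideal that does not
vanish on a coordinate subspace contains a power of the product of the coordinates of this
subspace. Hence in an equivariant module `T_i` consists of the elements killed by powers of all
products of `i + 1` coordinates (`mem_torsion_zero_iff`, `mem_torsion_one_iff`). This makes the
ideal of `Z₁` explicit; the partitions are read off along the generic points of the coordinate
planes (`pureIdeal_eq_unionIdeal`, `planePartition_unionIdeal`). It also shows that `T_1(O_Z)`
vanishes on the overlaps of the sets `x_i ≠ 0`, so that there is no obstruction to lifting sections
of `O_{Z₁}` over the punctured space to sections of `O_Z` (`LimHom.map_mkQ_surjective`).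

*`O_A` and `O_B` are saturated*: sections over the punctured space extend uniquely. For one
thickened plane the two free coordinates form a regular sequence (`IsMonomialIdeal.saturated`). For
unions the property follows from the exact sequence `0 → R/(J ∩ K) → R/J ⊕ R/K → R/(J + K) → 0` if
`R/(J + K)` has no element supported at the origin (`saturated_quotient_inf`); this holds for the
planes in `A`, and for those in `B`, because any two of them share a free coordinate
(`saturated_inf_inf`).

Now let `F` be a module with a section `s` that generates it away from the origin, without torsion
at the origin, and such that `s` has the annihilator of `O_{Z₁}`. By saturation there is a unique
map `ψ : F → O_A ⊕ O_B` with `ψ s = (1, 1)`; it is injective, it is equivariant whenever this makes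
sense, and its composite with the difference map to `O_W` lands in `T_0(O_W)` with kernel generated
by `s` (`Saturated.exists_extension`, `OriginTorsionFree.injective`,
`OriginTorsionFree.map_semilinear`, `differenceMap_mem_torsion_zero`). For `F = lim Hom(𝔪^r,
O_{Z₁})` every element of `T_0(O_W)` is reached, which gives the isomorphism of the first part
(`limQuot_equivariantlyIso`). For a fixed `PT₀` pair, the cokernel of the section is supported at
the origin, again because its annihilator is torus-fixed, so `F` is the preimage of a fixed
submodule of `T_0(O_W)` (`exists_pairOf_iso`). Such submodules correspond to sets of monomials in a
finite set (`finite_torusFixed_submodules`).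
-/

open SurfacePairs

namespace SurfacePairs

open MvPolynomial

/-! ### Monomial ideals -/

/-- `J` is the monomial ideal whose monomials are those with exponent in `D`: a polynomial lies in
`J` exactly if all its exponents lie in `D`. -/
def IsMonomialIdeal (J : Ideal R4) (D : Set (Fin 4 →₀ ℕ)) : Prop :=
  ∀ f : R4, f ∈ J ↔ ∀ v ∈ f.support, v ∈ D

theorem IsMonomialIdeal.monomial_mem_iff {J : Ideal R4} {D : Set (Fin 4 →₀ ℕ)}
    (h : IsMonomialIdeal J D) (v : Fin 4 →₀ ℕ) : (monomial v (1 : ℂ) : R4) ∈ J ↔ v ∈ D := by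
  rw [h]
  simp [MvPolynomial.support_monomial]

theorem monomial_mem_of_mem {J : Ideal R4} {v : Fin 4 →₀ ℕ} (c : ℂ)
    (h : (monomial v (1 : ℂ) : R4) ∈ J) : (monomial v c : R4) ∈ J := by
  have : (monomial v c : R4) = C c * monomial v 1 := by rw [C_mul_monomial, mul_one]
  rw [this]
  exact J.mul_mem_left _ h

theorem mem_of_forall_monomial_mem {J : Ideal R4} {f : R4}
    (h : ∀ v ∈ f.support, (monomial v (1 : ℂ) : R4) ∈ J) : f ∈ J := by
  rw [f.as_sum]
  exact J.sum_mem fun v hv => monomial_mem_of_mem _ (h v hv)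

theorem isMonomialIdeal_of_forall {J : Ideal R4}
    (h : ∀ f ∈ J, ∀ v ∈ f.support, (monomial v (1 : ℂ) : R4) ∈ J) :
    IsMonomialIdeal J {v | (monomial v (1 : ℂ) : R4) ∈ J} :=
  fun f => ⟨fun hf => h f hf, mem_of_forall_monomial_mem⟩

theorem IsMonomialIdeal.ext {J K : Ideal R4} {D E : Set (Fin 4 →₀ ℕ)}
    (hJ : IsMonomialIdeal J D) (hK : IsMonomialIdeal K E)
    (h : ∀ v : Fin 4 →₀ ℕ, (monomial v (1 : ℂ) : R4) ∈ J ↔ (monomial v (1 : ℂ) : R4) ∈ K) :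
    J = K := by
  have : D = E := by
    ext v
    rw [← hJ.monomial_mem_iff, h, hK.monomial_mem_iff]
  ext f
  rw [hJ f, hK f, this]

theorem IsMonomialIdeal.iInf {ι : Sort*} {J : ι → Ideal R4} {D : ι → Set (Fin 4 →₀ ℕ)}
    (h : ∀ i, IsMonomialIdeal (J i) (D i)) : IsMonomialIdeal (⨅ i, J i) (⋂ i, D i) := by
  intro f
  rw [Submodule.mem_iInf]
  simp only [fun i => h i f, Set.mem_iInter]
  exact ⟨fun H v hv i => H i v hv, fun H i v hv => H v hv i⟩

theorem IsMonomialIdeal.sup {J K : Ideal R4} {D E : Set (Fin 4 →₀ ℕ)}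
    (hJ : IsMonomialIdeal J D) (hK : IsMonomialIdeal K E) :
    IsMonomialIdeal (J ⊔ K) (D ∪ E) := by
  intro f
  constructor
  · intro hf v hv
    obtain ⟨a, ha, b, hb, rfl⟩ := Submodule.mem_sup.1 hf
    rcases Finset.mem_union.1 (MvPolynomial.support_add hv) with h | h
    · exact Or.inl ((hJ a).1 ha v h)
    · exact Or.inr ((hK b).1 hb v h)
  · intro h
    refine mem_of_forall_monomial_mem fun v hv => ?_
    rcases h v hv with h | h
    · exact Ideal.mem_sup_left ((hJ.monomial_mem_iff v).2 h)
    · exact Ideal.mem_sup_right ((hK.monomial_mem_iff v).2 h)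

theorem isMonomialIdeal_planeIdeal (p : CoordPair) {S : Set (ℕ × ℕ)} (hS : IsLowerSet S) :
    IsMonomialIdeal (planeIdeal p S) {v | (v p.1.1, v p.1.2) ∉ S} := by
  intro f
  rw [planeIdeal, mem_ideal_span_monomial_image]
  refine forall₂_congr fun v _ => ⟨?_, fun h => ⟨v, h, le_rfl⟩⟩
  rintro ⟨w, hw, hwv⟩ hv
  exact hw (hS (Prod.mk_le_mk.2 ⟨hwv _, hwv _⟩) hv)

theorem isMonomialIdeal_unionIdeal (P : Set CoordPair) {lam : CoordPair → Set (ℕ × ℕ)}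
    (hlam : ∀ p, IsLowerSet (lam p)) :
    IsMonomialIdeal (unionIdeal P lam) {v | ∀ p ∈ P, (v p.1.1, v p.1.2) ∉ lam p} := by
  have h := IsMonomialIdeal.iInf fun p : CoordPair =>
    IsMonomialIdeal.iInf fun _ : p ∈ P => isMonomialIdeal_planeIdeal p (hlam p)
  have e : {v : Fin 4 →₀ ℕ | ∀ p ∈ P, (v p.1.1, v p.1.2) ∉ lam p} =
      ⋂ p : CoordPair, ⋂ _ : p ∈ P, {v : Fin 4 →₀ ℕ | (v p.1.1, v p.1.2) ∉ lam p} := by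
    ext v
    simp only [Set.mem_ofPred_eq, Set.mem_iInter]
  rw [e]
  exact h

theorem add_single_mem_support {f : R4} {v : Fin 4 →₀ ℕ} (i : Fin 4) (k : ℕ)
    (hv : v ∈ f.support) : v + Finsupp.single i k ∈ (X i ^ k * f).support := by
  rw [mem_support_iff, X_pow_eq_monomial, add_comm, coeff_monomial_mul, one_mul]
  exact mem_support_iff.1 hv

/-! ### Torus-fixed ideals are monomial -/

/-- The value at the torus point `t` of the character by which the torus acts on `x^v`. -/
noncomputable def torusChar (t : Torus) (v : Fin 4 →₀ ℕ) : ℂ := ∏ i, ((t i : ℂˣ) : ℂ) ^ v i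

theorem coeff_torus_smul (t : Torus) (f : R4) (v : Fin 4 →₀ ℕ) :
    coeff v (t • f) = torusChar t v * coeff v f := by
  induction f using MvPolynomial.induction_on' with
  | monomial w c =>
    have h : (monomial w c : R4) = C c * monomial w 1 := by rw [C_mul_monomial, mul_one]
    have h1 : t • (C c : R4) = C c := (pull t).commutes c
    rw [h, smul_mul', h1, torus_smul_monomial, coeff_C_mul, coeff_C_mul, coeff_C_mul,
      coeff_monomial]
    split_ifs with e
    · subst e; rw [torusChar]; ring
    · simp
  | add p q hp hq => rw [smul_add, coeff_add, hp, hq, coeff_add, mul_add]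

/-- A point of the torus that separates all characters: its coordinates are distinct primes. -/
theorem exists_torusChar_injective : ∃ t : Torus, Function.Injective (torusChar t) := by
  let p : Fin 4 → ℕ := ![2, 3, 5, 7]
  have hp : ∀ i, (p i).Prime := by
    intro i; fin_cases i <;> norm_num [p]
  have hinj : Function.Injective p := by decide
  refine ⟨fun i => Units.mk0 (p i : ℂ) (Nat.cast_ne_zero.2 (hp i).ne_zero), fun v w h => ?_⟩
  have h1 : ∏ i, p i ^ v i = ∏ i, p i ^ w i := by
    have h2 : ((∏ i, p i ^ v i : ℕ) : ℂ) = ((∏ i, p i ^ w i : ℕ) : ℂ) := by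
      push_cast; exact h
    exact_mod_cast h2
  have key : ∀ (u : Fin 4 →₀ ℕ) (j : Fin 4), (∏ i, p i ^ u i).factorization (p j) = u j := by
    intro u j
    rw [Nat.factorization_prod (fun i _ => pow_ne_zero _ (hp i).ne_zero), Finsupp.finsetSum_apply,
      Finset.sum_eq_single j]
    · rw [(hp j).factorization_pow, Finsupp.single_eq_same]
    · intro i _ hij
      rw [(hp i).factorization_pow, Finsupp.single_apply, if_neg (fun e => hij (hinj e))]
    · simp
  ext j
  rw [← key v j, h1, key w j]

/-- A torus-fixed ideal is monomial: if `t` separates characters, then subtracting from `t • f` the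
multiple `χ_v(t) f` removes the monomial `x^v` and no other one. -/
theorem isMonomialIdeal_of_torusFixed {J : Ideal R4} (hJ : ∀ (t : Torus), ∀ f ∈ J, t • f ∈ J) :
    IsMonomialIdeal J {v | (monomial v (1 : ℂ) : R4) ∈ J} := by
  classical
  obtain ⟨t, ht⟩ := exists_torusChar_injective
  refine isMonomialIdeal_of_forall fun f hf => ?_
  induction hn : f.support.card using Nat.strong_induction_on generalizing f with
  | _ n ih =>
    have others : ∀ v ∈ f.support, ∀ w ∈ f.support, w ≠ v → (monomial w (1 : ℂ) : R4) ∈ J := by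
      intro v hv w hw hwv
      have hg : t • f - C (torusChar t v) * f ∈ J :=
        J.sub_mem (hJ t f hf) (J.mul_mem_left _ hf)
      have hc : ∀ u, coeff u (t • f - C (torusChar t v) * f) =
          (torusChar t u - torusChar t v) * coeff u f := by
        intro u
        rw [coeff_sub, coeff_torus_smul, coeff_C_mul, sub_mul]
      have hs : (t • f - C (torusChar t v) * f).support = f.support.erase v := by
        ext u
        rw [mem_support_iff, hc, Finset.mem_erase, mem_support_iff, mul_ne_zero_iff, sub_ne_zero,
          ht.ne_iff]
      refine ih _ ?_ _ hg rfl w ?_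
      · rw [hs, ← hn]; exact Finset.card_erase_lt_of_mem hv
      · rw [hs]; exact Finset.mem_erase.2 ⟨hwv, hw⟩
    intro v hv
    have h1 : f - ∑ w ∈ f.support.erase v, monomial w (coeff w f) = monomial v (coeff v f) := by
      conv_lhs => enter [1]; rw [f.as_sum]
      rw [← Finset.add_sum_erase _ _ hv, add_sub_cancel_right]
    have h2 : (monomial v (coeff v f) : R4) ∈ J := by
      rw [← h1]
      refine J.sub_mem hf (J.sum_mem fun w hw => monomial_mem_of_mem _ ?_)
      exact others v hv w (Finset.mem_of_mem_erase hw) (Finset.ne_of_mem_erase hw)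
    have h3 : (monomial v (1 : ℂ) : R4) = C (coeff v f)⁻¹ * monomial v (coeff v f) := by
      rw [C_mul_monomial, inv_mul_cancel₀ (mem_support_iff.1 hv)]
    rw [h3]
    exact J.mul_mem_left _ h2

/-! ### Torsion submodules of equivariant modules -/

/-- The ring homomorphism that sets the coordinates outside `S` to zero: restriction of functions
to the coordinate subspace with coordinates in `S`. -/
noncomputable def restrictCoord (S : Finset (Fin 4)) : R4 →ₐ[ℂ] MvPolynomial S ℂ :=
  aeval fun i => if h : i ∈ S then X ⟨i, h⟩ else 0

theorem restrictCoord_surjective (S : Finset (Fin 4)) :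
    Function.Surjective (restrictCoord S) := by
  intro f
  refine ⟨rename Subtype.val f, ?_⟩
  rw [restrictCoord, aeval_rename]
  have : ((fun i => if h : i ∈ S then (X ⟨i, h⟩ : MvPolynomial S ℂ) else 0) ∘ Subtype.val) =
      (X : S → MvPolynomial S ℂ) := by
    funext i
    simp
  rw [this, aeval_X_left_apply]

theorem restrictCoord_monomial_ne_zero {S : Finset (Fin 4)} {v : Fin 4 →₀ ℕ}
    (h : restrictCoord S (monomial v 1) ≠ 0) {i : Fin 4} (hi : i ∉ S) : v i = 0 := by
  by_contra hv
  apply h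
  rw [restrictCoord, aeval_monomial, map_one, one_mul]
  exact Finset.prod_eq_zero (Finsupp.mem_support_iff.2 hv) (by simp [hi, hv])

theorem ringKrullDim_mvPolynomial (S : Finset (Fin 4)) :
    ringKrullDim (MvPolynomial S ℂ) = (S.card : WithBot ℕ∞) := by
  rw [MvPolynomial.ringKrullDim_of_isNoetherianRing, ringKrullDim_eq_zero_of_field]
  simp

theorem not_le_ker_restrictCoord {J : Ideal R4} {i : ℕ} (h : ringKrullDim (R4 ⧸ J) ≤ i)
    {S : Finset (Fin 4)} (hS : i < S.card) : ∃ f ∈ J, restrictCoord S f ≠ 0 := by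
  by_contra! hJ
  have h1 := ringKrullDim_le_of_surjective
    (Ideal.Quotient.lift J (restrictCoord S).toRingHom hJ)
    (Ideal.Quotient.lift_surjective_of_surjective _ _ (restrictCoord_surjective S))
  rw [ringKrullDim_mvPolynomial] at h1
  have h2 := h1.trans h
  have : S.card ≤ i := by exact_mod_cast h2
  omega

/-- A torus-fixed ideal which does not vanish on the coordinate subspace with coordinates in `S`
contains a power of the product of these coordinates. -/
theorem prod_pow_mem_of_torusFixed {J : Ideal R4} (hJ : ∀ (t : Torus), ∀ f ∈ J, t • f ∈ J)
    {S : Finset (Fin 4)} (h : ∃ f ∈ J, restrictCoord S f ≠ 0) :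
    ∃ k : ℕ, (∏ i ∈ S, X i : R4) ^ k ∈ J := by
  obtain ⟨f, hf, hf0⟩ := h
  obtain ⟨v, hv, hv0⟩ : ∃ v ∈ f.support, restrictCoord S (monomial v 1) ≠ 0 := by
    by_contra! H
    apply hf0
    rw [f.as_sum, map_sum]
    refine Finset.sum_eq_zero fun v hv => ?_
    have : (monomial v (coeff v f) : R4) = C (coeff v f) * monomial v 1 := by
      rw [C_mul_monomial, mul_one]
    rw [this, map_mul, H v hv, mul_zero]
  have hvJ := (isMonomialIdeal_of_torusFixed hJ f).1 hf v hv
  refine ⟨∑ i, v i, ?_⟩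
  have hle : (∏ i ∈ S, X i : R4) ^ (∑ i, v i) =
      (∏ i ∈ S, X i ^ (∑ j, v j - v i)) * monomial v 1 := by
    rw [monomial_eq, C_1, one_mul, Finsupp.prod_fintype _ _ (fun _ => pow_zero _),
      ← Finset.prod_subset (Finset.subset_univ S)
        (fun i _ hi => by rw [restrictCoord_monomial_ne_zero hv0 hi, pow_zero]),
      ← Finset.prod_mul_distrib, ← Finset.prod_pow]
    refine Finset.prod_congr rfl fun i _ => ?_
    rw [← pow_add, Nat.sub_add_cancel (Finset.single_le_sum (fun _ _ => Nat.zero_le _)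
      (Finset.mem_univ i))]
  rw [hle]
  exact J.mul_mem_left _ hvJ

section Torsion

variable {M : Type*} [AddCommGroup M] [Module R4 M]

/-- A torsion element is killed by some function that does not vanish identically on a given
coordinate subspace of larger dimension: since such functions are closed under products, the
elements with this property form a submodule. -/
theorem exists_smul_eq_zero_of_mem_torsion {i : ℕ} {S : Finset (Fin 4)} (hS : i < S.card) {m : M}
    (hm : m ∈ torsion i M) : ∃ g : R4, restrictCoord S g ≠ 0 ∧ g • m = 0 := by
  let K : Submodule R4 M :=
    { carrier := {m | ∃ g : R4, restrictCoord S g ≠ 0 ∧ g • m = 0}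
      add_mem' := by
        rintro a b ⟨g, hg, hga⟩ ⟨h, hh, hhb⟩
        refine ⟨g * h, by rw [map_mul]; exact mul_ne_zero hg hh, ?_⟩
        rw [smul_add, mul_comm, mul_smul, hga, smul_zero, mul_comm, mul_smul, hhb, smul_zero,
          add_zero]
      zero_mem' := ⟨1, by simp, smul_zero _⟩
      smul_mem' := by
        rintro c a ⟨g, hg, hga⟩
        exact ⟨g, hg, by rw [smul_comm, hga, smul_zero]⟩ }
  have h : torsion i M ≤ K := by
    refine sSup_le fun N hN n hn => ?_
    have : Module.Finite R4 N := Module.Finite.iff_fg.2 hN.1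
    have hd := hN.2
    rw [Module.supportDim_eq_ringKrullDim_quotient_annihilator] at hd
    obtain ⟨g, hg, hg0⟩ := not_le_ker_restrictCoord hd hS
    exact ⟨g, hg0, congrArg Subtype.val (Module.mem_annihilator.1 hg ⟨n, hn⟩)⟩
  exact h hm

/-- In a coherent equivariant module, a power of the product of `i + 1` coordinates kills the
maximal submodule of dimension at most `i`. -/
theorem exists_prod_pow_smul_eq_zero [TorusModule M] [IsNoetherian R4 M] {i : ℕ}
    {S : Finset (Fin 4)} (hS : i < S.card) :
    ∃ k : ℕ, ∀ m ∈ torsion i M, (∏ j ∈ S, X j : R4) ^ k • m = 0 := by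
  classical
  let J : Ideal R4 := Module.annihilator R4 (torsion i M)
  have hmem : ∀ f : R4, f ∈ J ↔ ∀ m ∈ torsion i M, f • m = 0 := by
    intro f
    rw [Module.mem_annihilator]
    exact ⟨fun h m hm => congrArg Subtype.val (h ⟨m, hm⟩), fun h m => Subtype.ext (h m m.2)⟩
  have hJ : ∀ (t : Torus), ∀ f ∈ J, t • f ∈ J := by
    intro t f hf
    rw [hmem] at hf ⊢
    intro m hm
    have h1 := hf (t⁻¹ • m) (IsTorusFixed.smul_mem (N := torsion i M) t⁻¹ m hm)
    have h2 := congrArg (fun x => t • x) h1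
    simpa [TorusModule.smul_ring_smul] using h2
  obtain ⟨k, hk⟩ := prod_pow_mem_of_torusFixed (S := S) hJ (by
    obtain ⟨s, hs⟩ := IsNoetherian.noetherian (torsion i M)
    have hs' : ∀ m : s, ∃ g : R4, restrictCoord S g ≠ 0 ∧ g • (m : M) = 0 := fun m =>
      exists_smul_eq_zero_of_mem_torsion hS (hs ▸ Submodule.subset_span m.2)
    choose g hg hgm using hs'
    refine ⟨∏ m, g m, (hmem _).2 fun m hm => ?_, ?_⟩
    · rw [← hs] at hm
      induction hm using Submodule.span_induction with
      | mem x hx =>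
        rw [← Finset.prod_erase_mul _ _ (Finset.mem_univ ⟨x, hx⟩), mul_smul, hgm ⟨x, hx⟩,
          smul_zero]
      | zero => exact smul_zero _
      | add x y _ _ hx hy => rw [smul_add, hx, hy, add_zero]
      | smul c x _ hx => rw [smul_comm, hx, smul_zero]
    · rw [map_prod]
      exact Finset.prod_ne_zero_iff.2 fun m _ => hg m)
  exact ⟨k, (hmem _).1 hk⟩

/-- A module killed by powers of all products of `i + 1` coordinates is supported on the union of
the coordinate subspaces of dimension `i`, hence has dimension at most `i`. -/
theorem supportDim_le_of_prod_pow_smul_eq_zero {i : ℕ}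
    (h : ∀ S : Finset (Fin 4), S.card = i + 1 → ∃ k : ℕ, ∀ m : M, (∏ j ∈ S, X j : R4) ^ k • m = 0) :
    Module.supportDim R4 M ≤ (i : WithBot ℕ∞) := by
  classical
  refine iSup_le fun l => ?_
  let p : PrimeSpectrum R4 := l.head.1
  have hp : p ∈ Module.support R4 M := l.head.2
  let U : Finset (Fin 4) := Finset.univ.filter fun j => (X j : R4) ∉ p.asIdeal
  have hU : U.card ≤ i := by
    by_contra! hlt
    obtain ⟨S, hSU, hS⟩ := Finset.exists_subset_card_eq (show i + 1 ≤ U.card from hlt)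
    obtain ⟨k, hk⟩ := h S hS
    have h1 : (∏ j ∈ S, X j : R4) ^ k ∈ p.asIdeal :=
      Module.annihilator_le_of_mem_support hp (Module.mem_annihilator.2 hk)
    have h2 := (p.2.mem_of_pow_mem _ h1)
    obtain ⟨j, hj, hj'⟩ := (Ideal.IsPrime.prod_mem_iff (hp := p.2)).1 h2
    exact (Finset.mem_filter.1 (hSU hj)).2 hj'
  let φ : MvPolynomial U ℂ →ₐ[ℂ] R4 ⧸ p.asIdeal := aeval fun j => Ideal.Quotient.mk _ (X j)
  have hφ : Function.Surjective φ := by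
    have hX : ∀ j, Ideal.Quotient.mkₐ ℂ p.asIdeal (X j) ∈ φ.range := by
      intro j
      by_cases hj : (X j : R4) ∈ p.asIdeal
      · rw [Ideal.Quotient.mkₐ_eq_mk, Ideal.Quotient.eq_zero_iff_mem.2 hj]
        exact zero_mem _
      · exact ⟨X ⟨j, Finset.mem_filter.2 ⟨Finset.mem_univ _, hj⟩⟩, aeval_X _ _⟩
    intro y
    obtain ⟨f, rfl⟩ := Ideal.Quotient.mk_surjective y
    change Ideal.Quotient.mkₐ ℂ p.asIdeal f ∈ φ.range
    induction f using MvPolynomial.induction_on with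
    | C a => exact φ.range.algebraMap_mem a
    | add f g hf hg => rw [map_add]; exact add_mem hf hg
    | mul_X f j hf => rw [map_mul]; exact mul_mem hf (hX j)
  have hdim := ringKrullDim_le_of_surjective φ.toRingHom hφ
  rw [ringKrullDim_mvPolynomial, ringKrullDim_quotient] at hdim
  have hmono : Monotone (fun q : Module.support R4 M => q.1) := fun _ _ h => h
  let l' : LTSeries (PrimeSpectrum.zeroLocus (p.asIdeal : Set R4)) :=
    { length := l.length
      toFun := fun a => ⟨(l a).1, by
        rw [PrimeSpectrum.mem_zeroLocus]
        exact (show l.head ≤ l a from l.head_le a)⟩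
      step := fun a => l.step a }
  have h3 : ((l'.length : ℕ∞) : WithBot ℕ∞) ≤ U.card := (le_iSup (fun q : LTSeries
    (PrimeSpectrum.zeroLocus (p.asIdeal : Set R4)) => ((q.length : ℕ∞) : WithBot ℕ∞)) l').trans hdim
  have h4 : l.length ≤ U.card := by exact_mod_cast h3
  exact_mod_cast h4.trans hU

theorem mem_torsion_of_prod_pow_smul_eq_zero {i : ℕ} {m : M}
    (h : ∀ S : Finset (Fin 4), S.card = i + 1 → ∃ k : ℕ, (∏ j ∈ S, X j : R4) ^ k • m = 0) :
    m ∈ torsion i M := by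
  have h1 : Submodule.span R4 {m} ≤ torsion i M := by
    refine le_sSup ⟨Submodule.fg_span_singleton m, supportDim_le_of_prod_pow_smul_eq_zero ?_⟩
    intro S hS
    obtain ⟨k, hk⟩ := h S hS
    refine ⟨k, fun n => ?_⟩
    obtain ⟨c, hc⟩ := Submodule.mem_span_singleton.1 n.2
    apply Subtype.ext
    change (∏ j ∈ S, X j : R4) ^ k • (n : M) = 0
    rw [← hc, smul_comm, hk, smul_zero]
  exact h1 (Submodule.mem_span_singleton_self m)

theorem pow_smul_eq_zero_of_le {f : R4} {k l : ℕ} (hkl : k ≤ l) {m : M} (h : f ^ k • m = 0) :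
    f ^ l • m = 0 := by
  rw [← Nat.sub_add_cancel hkl, pow_add, mul_smul, h, smul_zero]

theorem mem_torsion_zero_of_forall_X_pow {m : M} (h : ∀ i, ∃ k : ℕ, (X i : R4) ^ k • m = 0) :
    m ∈ torsion 0 M := by
  refine mem_torsion_of_prod_pow_smul_eq_zero fun S hS => ?_
  obtain ⟨i, rfl⟩ := Finset.card_eq_one.1 hS
  simpa using h i

theorem mem_torsion_zero_iff [TorusModule M] [IsNoetherian R4 M] {m : M} :
    m ∈ torsion 0 M ↔ ∀ i, ∃ k : ℕ, (X i : R4) ^ k • m = 0 := by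
  refine ⟨fun hm i => ?_, mem_torsion_zero_of_forall_X_pow⟩
  obtain ⟨k, hk⟩ := exists_prod_pow_smul_eq_zero (M := M) (i := 0) (S := {i}) (by simp)
  exact ⟨k, by simpa using hk m hm⟩

theorem mem_torsion_one_iff [TorusModule M] [IsNoetherian R4 M] {m : M} :
    m ∈ torsion 1 M ↔ ∀ i j, i ≠ j → ∃ k : ℕ, (X i * X j : R4) ^ k • m = 0 := by
  refine ⟨fun hm i j hij => ?_, fun h => mem_torsion_of_prod_pow_smul_eq_zero fun S hS => ?_⟩
  · obtain ⟨k, hk⟩ := exists_prod_pow_smul_eq_zero (M := M) (i := 1) (S := {i, j})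
      (by rw [Finset.card_pair hij]; norm_num)
    exact ⟨k, by simpa [Finset.prod_pair hij] using hk m hm⟩
  · obtain ⟨i, j, hij, rfl⟩ := Finset.card_eq_two.1 hS
    simpa [Finset.prod_pair hij] using h i j hij

end Torsion

/-! ### Saturated modules -/

section Saturated

variable {M N : Type*} [AddCommGroup M] [Module R4 M] [AddCommGroup N] [Module R4 N]

/-- No non-zero element is killed by a power of the ideal of the origin, i.e. `H⁰_𝔪(M) = 0`. It
suffices to consider a common power of the four coordinates. -/
def OriginTorsionFree (M : Type*) [AddCommGroup M] [Module R4 M] : Prop :=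
  ∀ (k : ℕ) (m : M), (∀ i, (X i : R4) ^ k • m = 0) → m = 0

/-- Every section of `M` over the punctured affine space extends uniquely to a global section, i.e.
`H⁰_𝔪(M) = H¹_𝔪(M) = 0`. A section over the punctured space is given by the compatible fractions
`a i / x_i^k`. -/
def Saturated (M : Type*) [AddCommGroup M] [Module R4 M] : Prop :=
  OriginTorsionFree M ∧ ∀ (k : ℕ) (a : Fin 4 → M),
    (∀ i j, (X j : R4) ^ k • a i = (X i : R4) ^ k • a j) → ∃ m, ∀ i, (X i : R4) ^ k • m = a i

/-- A common exponent for the four coordinates. -/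
theorem exists_uniform_pow {p : Fin 4 → ℕ → Prop} (hp : ∀ i k l, k ≤ l → p i k → p i l)
    (h : ∀ i, ∃ k, p i k) : ∃ k, ∀ i, p i k := by
  choose k hk using h
  exact ⟨∑ i, k i, fun i => hp i _ _
    (Finset.single_le_sum (fun _ _ => Nat.zero_le _) (Finset.mem_univ i)) (hk i)⟩

theorem OriginTorsionFree.eq_zero (hM : OriginTorsionFree M) {m : M}
    (h : ∀ i, ∃ k : ℕ, (X i : R4) ^ k • m = 0) : m = 0 := by
  obtain ⟨k, hk⟩ := exists_uniform_pow (p := fun i k => (X i : R4) ^ k • m = 0)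
    (fun _ _ _ h => pow_smul_eq_zero_of_le h) h
  exact hM k m hk

theorem originTorsionFree_of_torsion_zero (h : torsion 0 M = ⊥) : OriginTorsionFree M := by
  intro k m hm
  have h1 : m ∈ torsion 0 M := mem_torsion_zero_of_forall_X_pow fun i => ⟨k, hm i⟩
  rwa [h, Submodule.mem_bot] at h1

theorem OriginTorsionFree.of_injective (hN : OriginTorsionFree N) (f : M →ₗ[R4] N)
    (hf : Function.Injective f) : OriginTorsionFree M := by
  intro k m hm
  apply hf
  rw [map_zero]
  refine hN k _ fun i => ?_
  rw [← map_smul, hm, map_zero]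

theorem OriginTorsionFree.prod (hM : OriginTorsionFree M) (hN : OriginTorsionFree N) :
    OriginTorsionFree (M × N) := fun k _ h =>
  Prod.ext (hM k _ fun i => congrArg Prod.fst (h i)) (hN k _ fun i => congrArg Prod.snd (h i))

theorem Saturated.prod (hM : Saturated M) (hN : Saturated N) : Saturated (M × N) := by
  refine ⟨hM.1.prod hN.1, fun k a h => ?_⟩
  obtain ⟨m, hm⟩ := hM.2 k (fun i => (a i).1) fun i j => congrArg Prod.fst (h i j)
  obtain ⟨n, hn⟩ := hN.2 k (fun i => (a i).2) fun i j => congrArg Prod.snd (h i j)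
  exact ⟨(m, n), fun i => Prod.ext (hm i) (hn i)⟩

/-- A linear map from `F` to a module without torsion at the origin is determined by its value at a
section that generates `F` away from the origin. -/
theorem OriginTorsionFree.hom_ext {F : Type*} [AddCommGroup F] [Module R4 F]
    (hM : OriginTorsionFree M) {s : F}
    (hs : ∀ f : F, ∀ i, ∃ (k : ℕ) (c : R4), (X i : R4) ^ k • f = c • s) {φ ψ : F →ₗ[R4] M}
    (h : φ s = ψ s) : φ = ψ := by
  ext f
  rw [← sub_eq_zero]
  refine hM.eq_zero fun i => ?_
  obtain ⟨k, c, hc⟩ := hs f i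
  refine ⟨k, ?_⟩
  rw [smul_sub, ← map_smul, ← map_smul, hc, map_smul, map_smul, h, sub_self]

/-- If the section `s` generates `F` away from the origin, then the assignment `s ↦ e` extends to a
homomorphism from `F` to any saturated module. -/
theorem Saturated.exists_extension {F : Type*} [AddCommGroup F] [Module R4 F] (hM : Saturated M)
    {s : F} {e : M} (hs : ∀ f : F, ∀ i, ∃ (k : ℕ) (c : R4), (X i : R4) ^ k • f = c • s)
    (he : ∀ c : R4, c • s = 0 → c • e = 0) : ∃ ψ : F →ₗ[R4] M, ψ s = e := by
  have he' : ∀ c d : R4, c • s = d • s → c • e = d • e := by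
    intro c d h
    rw [← sub_eq_zero, ← sub_smul] at h ⊢
    exact he _ h
  -- The value at `f` is characterized by compatibility with every multiple of `f` in `R • s`.
  have key : ∀ f : F, ∃ m : M, ∀ r c : R4, r • f = c • s → r • m = c • e := by
    intro f
    obtain ⟨k, hk⟩ := exists_uniform_pow (p := fun i k => ∃ c : R4, (X i : R4) ^ k • f = c • s)
      (by
        rintro i k l hkl ⟨c, hc⟩
        refine ⟨X i ^ (l - k) * c, ?_⟩
        rw [← Nat.sub_add_cancel hkl, pow_add, mul_smul, hc, smul_smul, Nat.add_sub_cancel]) (hs f)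
    choose c hc using hk
    obtain ⟨m, hm⟩ := hM.2 k (fun i => c i • e) fun i j => by
      rw [smul_smul, smul_smul]
      apply he'
      rw [mul_smul, mul_smul, ← hc, ← hc, smul_comm]
    refine ⟨m, fun r d hr => ?_⟩
    rw [← sub_eq_zero]
    refine hM.1 k _ fun i => ?_
    rw [smul_sub, smul_comm, hm, smul_smul, smul_smul, sub_eq_zero]
    apply he'
    rw [mul_smul, mul_smul, ← hc, ← hr, smul_comm]
  have uniq : ∀ (f : F) (m m' : M), (∀ r c : R4, r • f = c • s → r • m = c • e) →
      (∀ r c : R4, r • f = c • s → r • m' = c • e) → m = m' := by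
    intro f m m' h h'
    rw [← sub_eq_zero]
    refine hM.1.eq_zero fun i => ?_
    obtain ⟨k, c, hc⟩ := hs f i
    exact ⟨k, by rw [smul_sub, h _ _ hc, h' _ _ hc, sub_self]⟩
  choose ψ hψ using key
  refine ⟨{ toFun := ψ, map_add' := fun f g => ?_, map_smul' := fun a f => ?_ }, ?_⟩
  · rw [← sub_eq_zero]
    refine hM.1.eq_zero fun i => ?_
    obtain ⟨k, c, hc⟩ := hs f i
    obtain ⟨l, d, hd⟩ := hs g i
    have hf : (X i : R4) ^ (k + l) • f = (X i ^ l * c) • s := by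
      rw [add_comm, pow_add, mul_smul, hc, mul_smul]
    have hg : (X i : R4) ^ (k + l) • g = (X i ^ k * d) • s := by
      rw [pow_add, mul_smul, hd, mul_smul]
    refine ⟨k + l, ?_⟩
    rw [smul_sub, smul_add, hψ f _ _ hf, hψ g _ _ hg, ← add_smul, sub_eq_zero]
    apply hψ
    rw [smul_add, hf, hg, add_smul]
  · refine uniq (a • f) _ _ (hψ _) fun r c hr => ?_
    rw [RingHom.id_apply, smul_smul]
    apply hψ
    rw [mul_smul, hr]
  · refine uniq s _ _ (hψ s) fun r c hr => he' _ _ hr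

/-- A map to a module without torsion at the origin is determined away from the origin: it is
injective if it is so on the submodule generated by `s`. -/
theorem OriginTorsionFree.injective {F : Type*} [AddCommGroup F] [Module R4 F]
    (hF : OriginTorsionFree F) {s : F}
    (hs : ∀ f : F, ∀ i, ∃ (k : ℕ) (c : R4), (X i : R4) ^ k • f = c • s) (ψ : F →ₗ[R4] M)
    (h : ∀ c : R4, c • ψ s = 0 → c • s = 0) : Function.Injective ψ := by
  rw [injective_iff_map_eq_zero]
  intro f hf
  refine hF.eq_zero fun i => ?_
  obtain ⟨k, c, hc⟩ := hs f i
  refine ⟨k, ?_⟩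
  rw [hc]
  apply h
  rw [← map_smul, ← hc, map_smul, hf, smul_zero]

end Saturated

/-! ### Saturation of quotients by monomial ideals -/

theorem smul_mk_eq_mk_mul (J : Ideal R4) (f g : R4) :
    f • (Ideal.Quotient.mk J g) = Ideal.Quotient.mk J (f * g) := rfl

theorem originTorsionFree_quotient_iff {J : Ideal R4} :
    OriginTorsionFree (R4 ⧸ J) ↔ ∀ (k : ℕ) (f : R4), (∀ i, X i ^ k * f ∈ J) → f ∈ J := by
  constructor
  · intro h k f hf
    rw [← Ideal.Quotient.eq_zero_iff_mem]
    refine h k _ fun i => ?_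
    rw [smul_mk_eq_mk_mul, Ideal.Quotient.eq_zero_iff_mem]
    exact hf i
  · intro h k m hm
    obtain ⟨f, rfl⟩ := Ideal.Quotient.mk_surjective m
    rw [Ideal.Quotient.eq_zero_iff_mem]
    refine h k f fun i => ?_
    rw [← Ideal.Quotient.eq_zero_iff_mem, ← smul_mk_eq_mk_mul]
    exact hm i

theorem saturated_quotient_iff {J : Ideal R4} :
    Saturated (R4 ⧸ J) ↔ OriginTorsionFree (R4 ⧸ J) ∧ ∀ (k : ℕ) (f : Fin 4 → R4),
      (∀ i j, X j ^ k * f i - X i ^ k * f j ∈ J) → ∃ g, ∀ i, X i ^ k * g - f i ∈ J := by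
  refine and_congr_right fun _ => ⟨fun h k f hf => ?_, fun h k a ha => ?_⟩
  · obtain ⟨m, hm⟩ := h k (fun i => Ideal.Quotient.mk J (f i)) fun i j => by
      rw [smul_mk_eq_mk_mul, smul_mk_eq_mk_mul, Ideal.Quotient.eq]
      exact hf i j
    obtain ⟨g, rfl⟩ := Ideal.Quotient.mk_surjective m
    refine ⟨g, fun i => ?_⟩
    rw [← Ideal.Quotient.eq, ← smul_mk_eq_mk_mul]
    exact hm i
  · choose f hf using fun i => Ideal.Quotient.mk_surjective (a i)
    obtain ⟨g, hg⟩ := h k f fun i j => by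
      rw [← Ideal.Quotient.eq, ← smul_mk_eq_mk_mul, ← smul_mk_eq_mk_mul, hf, hf]
      exact ha i j
    refine ⟨Ideal.Quotient.mk J g, fun i => ?_⟩
    rw [← hf, smul_mk_eq_mk_mul, Ideal.Quotient.eq]
    exact hg i

/-- The union of two subschemes with saturated structure sheaves has a saturated structure sheaf if
their intersection has no embedded point at the origin. -/
theorem saturated_quotient_inf {J K : Ideal R4} (hJ : Saturated (R4 ⧸ J))
    (hK : Saturated (R4 ⧸ K)) (hJK : OriginTorsionFree (R4 ⧸ (J ⊔ K))) :
    Saturated (R4 ⧸ (J ⊓ K)) := by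
  rw [saturated_quotient_iff] at hJ hK ⊢
  rw [originTorsionFree_quotient_iff] at hJ hK hJK ⊢
  refine ⟨fun k f h => ⟨hJ.1 k f fun i => (h i).1, hK.1 k f fun i => (h i).2⟩, fun k f hf => ?_⟩
  obtain ⟨g, hg⟩ := hJ.2 k f fun i j => (hf i j).1
  obtain ⟨h, hh⟩ := hK.2 k f fun i j => (hf i j).2
  have hgh : g - h ∈ J ⊔ K := by
    refine hJK k _ fun i => ?_
    have e : X i ^ k * (g - h) = (X i ^ k * g - f i) - (X i ^ k * h - f i) := by ring
    rw [e]
    exact (J ⊔ K).sub_mem (Ideal.mem_sup_left (hg i)) (Ideal.mem_sup_right (hh i))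
  obtain ⟨a, ha, b, hb, hab⟩ := Submodule.mem_sup.1 hgh
  refine ⟨g - a, fun i => ⟨?_, ?_⟩⟩
  · have e : X i ^ k * (g - a) - f i = (X i ^ k * g - f i) - X i ^ k * a := by ring
    rw [e]
    exact J.sub_mem (hg i) (J.mul_mem_left _ ha)
  · have e : X i ^ k * (g - a) - f i = (X i ^ k * h - f i) + X i ^ k * b := by
      have e' : g - a = h + b := by linear_combination -hab
      rw [e']; ring
    rw [e]
    exact K.add_mem (hh i) (K.mul_mem_left _ hb)

/-- A monomial ideal has no torsion at the origin if every monomial outside it stays outside under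
multiplication by all powers of some coordinate. -/
theorem IsMonomialIdeal.originTorsionFree {J : Ideal R4} {D : Set (Fin 4 →₀ ℕ)}
    (hJ : IsMonomialIdeal J D)
    (hD : ∀ v, v ∉ D → ∃ i, ∀ n, v + Finsupp.single i n ∉ D) : OriginTorsionFree (R4 ⧸ J) := by
  rw [originTorsionFree_quotient_iff]
  refine fun k f hf => (hJ f).2 fun v hv => ?_
  by_contra hvD
  obtain ⟨i, hi⟩ := hD v hvD
  exact hi k ((hJ _).1 (hf i) _ (add_single_mem_support i k hv))

theorem isMonomialIdeal_span_X_pow (c : Fin 4) (k : ℕ) :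
    IsMonomialIdeal (Ideal.span {(X c : R4) ^ k}) {v | k ≤ v c} := by
  intro f
  have h : ({(X c : R4) ^ k} : Set R4) = (fun v => monomial v (1 : ℂ)) '' {Finsupp.single c k} := by
    rw [Set.image_singleton, X_pow_eq_monomial]
  rw [h, mem_ideal_span_monomial_image]
  refine forall₂_congr fun v _ => ?_
  simp [Finsupp.single_le_iff]

/-- If membership of a monomial in `J` does not depend on the exponents of `x_c` and `x_d`, then
these two coordinates form a regular sequence on `R / J`, and so `R / J` is saturated. -/
theorem IsMonomialIdeal.saturated {J : Ideal R4} {D : Set (Fin 4 →₀ ℕ)} (hJ : IsMonomialIdeal J D)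
    {c d : Fin 4} (hcd : c ≠ d) (hc : ∀ v n, v + Finsupp.single c n ∈ D ↔ v ∈ D)
    (hd : ∀ v n, v + Finsupp.single d n ∈ D ↔ v ∈ D) : Saturated (R4 ⧸ J) := by
  have reg : ∀ (k : ℕ) (f : R4), X c ^ k * f ∈ J → f ∈ J := fun k f h =>
    (hJ f).2 fun v hv => (hc v k).1 ((hJ _).1 h _ (add_single_mem_support c k hv))
  have reg' : ∀ (k : ℕ) (f : R4), X d ^ k * f ∈ J ⊔ Ideal.span {X c ^ k} →
      f ∈ J ⊔ Ideal.span {X c ^ k} := by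
    intro k f h
    have hm := hJ.sup (isMonomialIdeal_span_X_pow c k)
    refine (hm f).2 fun v hv => ?_
    rcases (hm _).1 h _ (add_single_mem_support d k hv) with h | h
    · exact Or.inl ((hd v k).1 h)
    · refine Or.inr ?_
      change k ≤ (v + Finsupp.single d k) c at h
      rwa [Finsupp.add_apply, Finsupp.single_eq_of_ne hcd, add_zero] at h
  rw [saturated_quotient_iff, originTorsionFree_quotient_iff]
  refine ⟨fun k f h => reg k f (h c), fun k f hf => ?_⟩
  have h1 : f c ∈ J ⊔ Ideal.span {X c ^ k} := by
    apply reg'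
    have e : X d ^ k * f c = (X d ^ k * f c - X c ^ k * f d) + X c ^ k * f d := by ring
    rw [e]
    exact Ideal.add_mem _ (Ideal.mem_sup_left (hf c d))
      (Ideal.mem_sup_right (Ideal.mul_mem_right _ _ (Ideal.mem_span_singleton_self _)))
  obtain ⟨a, ha, b, hb, hab⟩ := Submodule.mem_sup.1 h1
  obtain ⟨g, rfl⟩ := Ideal.mem_span_singleton'.1 hb
  refine ⟨g, fun i => reg k _ ?_⟩
  have e : X c ^ k * (X i ^ k * g - f i) = (X i ^ k * f c - X c ^ k * f i) - X i ^ k * a := by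
    rw [← hab]; ring
  rw [e]
  exact J.sub_mem (hf c i) (J.mul_mem_left _ ha)

theorem exists_complementary (p : CoordPair) :
    ∃ c d : Fin 4, c ≠ d ∧ c ≠ p.1.1 ∧ c ≠ p.1.2 ∧ d ≠ p.1.1 ∧ d ≠ p.1.2 := by
  revert p; decide

theorem saturated_planeIdeal (p : CoordPair) {S : Set (ℕ × ℕ)} (hS : IsLowerSet S) :
    Saturated (R4 ⧸ planeIdeal p S) := by
  obtain ⟨c, d, hcd, h1, h2, h3, h4⟩ := exists_complementary p
  refine (isMonomialIdeal_planeIdeal p hS).saturated hcd (fun v n => ?_) (fun v n => ?_)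
  · change ((v + Finsupp.single c n) p.1.1, (v + Finsupp.single c n) p.1.2) ∉ S ↔ _
    rw [Finsupp.add_apply, Finsupp.add_apply, Finsupp.single_eq_of_ne h1.symm,
      Finsupp.single_eq_of_ne h2.symm]
    rfl
  · change ((v + Finsupp.single d n) p.1.1, (v + Finsupp.single d n) p.1.2) ∉ S ↔ _
    rw [Finsupp.add_apply, Finsupp.add_apply, Finsupp.single_eq_of_ne h3.symm,
      Finsupp.single_eq_of_ne h4.symm]
    rfl

/-- The union of three thickened coordinate planes has a saturated structure sheaf if for any two of
the planes some coordinate is free on both of them: raising this coordinate shows that the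
intersection of two of them, and that of the third with the union of the other two, has no embedded
point at the origin. -/
theorem saturated_inf_inf {p q r : CoordPair} {lam : CoordPair → Set (ℕ × ℕ)}
    (hlam : ∀ p, IsLowerSet (lam p))
    (hpq : ∃ c, c ≠ p.1.1 ∧ c ≠ p.1.2 ∧ c ≠ q.1.1 ∧ c ≠ q.1.2)
    (hpr : ∃ c, c ≠ p.1.1 ∧ c ≠ p.1.2 ∧ c ≠ r.1.1 ∧ c ≠ r.1.2)
    (hqr : ∃ c, c ≠ q.1.1 ∧ c ≠ q.1.2 ∧ c ≠ r.1.1 ∧ c ≠ r.1.2) :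
    Saturated (R4 ⧸ (planeIdeal p (lam p) ⊓ planeIdeal q (lam q) ⊓ planeIdeal r (lam r))) := by
  have hmon := fun p => isMonomialIdeal_planeIdeal p (hlam p)
  -- A coordinate that is not involved in the two conditions satisfied by `v` can be raised.
  have raise : ∀ {p q : CoordPair}, (∃ c, c ≠ p.1.1 ∧ c ≠ p.1.2 ∧ c ≠ q.1.1 ∧ c ≠ q.1.2) →
      ∀ v : Fin 4 →₀ ℕ, (v p.1.1, v p.1.2) ∈ lam p → (v q.1.1, v q.1.2) ∈ lam q →
      ∃ i, ∀ n : ℕ, ∀ w : Fin 4 →₀ ℕ, w = v + Finsupp.single i n →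
        (w p.1.1, w p.1.2) ∈ lam p ∧ (w q.1.1, w q.1.2) ∈ lam q := by
    rintro p q ⟨c, h1, h2, h3, h4⟩ v hp hq
    refine ⟨c, ?_⟩
    rintro n _ rfl
    simp only [Finsupp.add_apply, Finsupp.single_eq_of_ne h1.symm, Finsupp.single_eq_of_ne h2.symm,
      Finsupp.single_eq_of_ne h3.symm, Finsupp.single_eq_of_ne h4.symm, add_zero]
    exact ⟨hp, hq⟩
  have hinf : IsMonomialIdeal (planeIdeal p (lam p) ⊓ planeIdeal q (lam q))
      ({v | (v p.1.1, v p.1.2) ∉ lam p} ∩ {v | (v q.1.1, v q.1.2) ∉ lam q}) := by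
    intro f
    rw [Submodule.mem_inf, hmon p, hmon q]
    exact ⟨fun h v hv => ⟨h.1 v hv, h.2 v hv⟩, fun h => ⟨fun v hv => (h v hv).1,
      fun v hv => (h v hv).2⟩⟩
  refine saturated_quotient_inf (saturated_quotient_inf (saturated_planeIdeal p (hlam p))
    (saturated_planeIdeal q (hlam q)) ?_) (saturated_planeIdeal r (hlam r)) ?_
  · refine ((hmon p).sup (hmon q)).originTorsionFree fun v hv => ?_
    have hv' := not_or.1 hv
    obtain ⟨i, hi⟩ := raise hpq v (not_not.1 hv'.1) (not_not.1 hv'.2)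
    exact ⟨i, fun n => not_or.2 ⟨not_not.2 (hi n _ rfl).1, not_not.2 (hi n _ rfl).2⟩⟩
  · refine (hinf.sup (hmon r)).originTorsionFree fun v hv => ?_
    have hv' := not_or.1 hv
    rcases not_and_or.1 hv'.1 with h | h
    · obtain ⟨i, hi⟩ := raise hpr v (not_not.1 h) (not_not.1 hv'.2)
      exact ⟨i, fun n => not_or.2 ⟨fun h' => h'.1 (hi n _ rfl).1, not_not.2 (hi n _ rfl).2⟩⟩
    · obtain ⟨i, hi⟩ := raise hqr v (not_not.1 h) (not_not.1 hv'.2)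
      exact ⟨i, fun n => not_or.2 ⟨fun h' => h'.2 (hi n _ rfl).1, not_not.2 (hi n _ rfl).2⟩⟩

theorem unionIdeal_eq_inf_inf {P : Set CoordPair} {p q r : CoordPair}
    (h : ∀ x, x ∈ P ↔ x = p ∨ x = q ∨ x = r) (lam : CoordPair → Set (ℕ × ℕ)) :
    unionIdeal P lam =
      planeIdeal p (lam p) ⊓ planeIdeal q (lam q) ⊓ planeIdeal r (lam r) := by
  simp only [unionIdeal, h, iInf_or, iInf_inf_eq, iInf_iInf_eq_left, inf_assoc]

theorem saturated_pairsA {lam : CoordPair → Set (ℕ × ℕ)} (hlam : ∀ p, IsLowerSet (lam p)) :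
    Saturated (R4 ⧸ unionIdeal pairsA lam) := by
  have h : ∀ x, x ∈ pairsA ↔ x = ⟨(0, 1), by decide⟩ ∨ x = ⟨(0, 2), by decide⟩ ∨
      x = ⟨(1, 2), by decide⟩ := by
    change ∀ x : CoordPair, x.1.2 ≠ 3 ↔ _
    decide
  rw [unionIdeal_eq_inf_inf h]
  exact saturated_inf_inf hlam ⟨3, by decide⟩ ⟨3, by decide⟩ ⟨3, by decide⟩

theorem saturated_pairsB {lam : CoordPair → Set (ℕ × ℕ)} (hlam : ∀ p, IsLowerSet (lam p)) :
    Saturated (R4 ⧸ unionIdeal pairsB lam) := by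
  have h : ∀ x, x ∈ pairsB ↔ x = ⟨(0, 3), by decide⟩ ∨ x = ⟨(1, 3), by decide⟩ ∨
      x = ⟨(2, 3), by decide⟩ := by
    change ∀ x : CoordPair, x.1.2 = 3 ↔ _
    decide
  rw [unionIdeal_eq_inf_inf h]
  exact saturated_inf_inf hlam ⟨2, by decide⟩ ⟨1, by decide⟩ ⟨0, by decide⟩

/-! ### Sections over the punctured affine space as a direct limit -/

/-- The ideal of the origin in the coordinate ring of affine space. -/
noncomputable def coordIdeal : Ideal R4 := Ideal.span (Set.range (X : Fin 4 → R4))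

theorem coordIdeal_fg : coordIdeal.FG := IsNoetherian.noetherian _

theorem mem_originPow_iff {I : Ideal R4} {r : ℕ} {a : R4 ⧸ I} :
    a ∈ originPow I r ↔ ∃ f ∈ coordIdeal ^ r, Ideal.Quotient.mk I f = a := by
  change a ∈ originIdeal I ^ r ↔ _
  rw [originIdeal, ← Ideal.map_pow, Ideal.mem_map_iff_of_surjective _ Ideal.Quotient.mk_surjective]
  rfl

theorem mk_X_pow_mul_mem_originPow (I : Ideal R4) (r : ℕ) (i : Fin 4) (f : R4) :
    Ideal.Quotient.mk I (X i ^ r * f) ∈ originPow I r :=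
  mem_originPow_iff.2 ⟨_, Ideal.mul_mem_right _ _
    (Ideal.pow_mem_pow (show X i ∈ coordIdeal from Ideal.subset_span ⟨i, rfl⟩) r), rfl⟩

namespace LimHom

variable {I : Ideal R4} {M N : Type*} [AddCommGroup M] [Module R4 M] [AddCommGroup N] [Module R4 N]

theorem of_eq_zero_iff {r : ℕ} (g : PowHom I M r) :
    of I r g = 0 ↔ ∃ (s : ℕ) (h : r ≤ s), powRestrict I M r s h g = 0 := by
  rw [← map_zero (of (M := M) I r), of_eq_of]
  constructor
  · rintro ⟨k, hr, _, h⟩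
    exact ⟨k, hr, by rw [h, map_zero]⟩
  · rintro ⟨k, hr, h⟩
    exact ⟨k, hr, hr, by rw [h, map_zero]⟩

theorem of_injective (hM : OriginTorsionFree M) {r : ℕ} {g : PowHom I M r} (h : of I r g = 0) :
    g = 0 := by
  obtain ⟨s, hs, h⟩ := (of_eq_zero_iff g).1 h
  ext ⟨a, ha⟩
  refine hM s _ fun i => ?_
  obtain ⟨f, rfl⟩ := Ideal.Quotient.mk_surjective a
  have hmem := mk_X_pow_mul_mem_originPow I s i f
  have h1 : g ⟨_, originPow_anti I hs hmem⟩ = 0 := LinearMap.congr_fun h ⟨_, hmem⟩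
  change (X i : R4) ^ s • g _ = 0
  rw [← map_smul, ← h1]
  rfl

theorem originTorsionFree (hM : OriginTorsionFree M) : OriginTorsionFree (LimHom I M) := by
  intro k x hx
  obtain ⟨r, g, rfl⟩ := exists_of x
  have hg : g = 0 := by
    ext a
    refine hM k _ fun i => ?_
    have h1 := hx i
    rw [← map_smul] at h1
    exact LinearMap.congr_fun (of_injective hM h1) a
  rw [hg, map_zero]

theorem canonical_injective [IsModuleOn I M] (hM : OriginTorsionFree M) :
    Function.Injective (canonical I M) := by
  rw [injective_iff_map_eq_zero]
  intro m hm
  have h1 := LinearMap.congr_fun (of_injective hM hm)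
    ⟨Ideal.Quotient.mk I 1, mem_originPow_iff.2 ⟨1, by simp, rfl⟩⟩
  have h2 : (1 : R4) • m = 0 := h1
  rwa [one_smul] at h2

/-- Multiplication by a high power of a coordinate makes a section over the punctured space
extend. -/
theorem exists_pow_smul_eq_canonical [IsModuleOn I M] (x : LimHom I M) :
    ∃ (r : ℕ) (n : Fin 4 → M), ∀ i, (X i : R4) ^ r • x = canonical I M (n i) := by
  obtain ⟨r, g, rfl⟩ := exists_of x
  refine ⟨r, fun i => g ⟨Ideal.Quotient.mk I (X i ^ r * 1), mk_X_pow_mul_mem_originPow I r i 1⟩,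
    fun i => ?_⟩
  rw [canonical_apply, ← map_smul, of_eq_of]
  refine ⟨r, le_rfl, Nat.zero_le _, ?_⟩
  ext ⟨a, ha⟩
  obtain ⟨f, rfl⟩ := Ideal.Quotient.mk_surjective a
  change (X i : R4) ^ r • g _ = f • g _
  refine (map_smul g _ _).symm.trans ((congrArg g (Subtype.ext ?_)).trans (map_smul g f _))
  change Ideal.Quotient.mk I (X i ^ r * f) = Ideal.Quotient.mk I (f * (X i ^ r * 1))
  rw [mul_one, mul_comm]

/-- Compatible fractions `a i / x_i^k` define an element of the direct limit. -/
theorem exists_pow_smul_eq [IsModuleOn I M] (hM : OriginTorsionFree M) {k : ℕ} {a : Fin 4 → M}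
    (h : ∀ i j, (X j : R4) ^ k • a i = (X i : R4) ^ k • a j) :
    ∃ x : LimHom I M, ∀ i, (X i : R4) ^ k • x = canonical I M (a i) := by
  -- The polynomials by which the section can be multiplied to become a global one.
  let J : Ideal R4 :=
    { carrier := {f | ∃ m, ∀ i, (X i : R4) ^ k • m = f • a i}
      add_mem' := by
        rintro f g ⟨m, hm⟩ ⟨n, hn⟩
        exact ⟨m + n, fun i => by rw [smul_add, hm, hn, add_smul]⟩
      zero_mem' := ⟨0, fun i => by rw [smul_zero, zero_smul]⟩
      smul_mem' := by
        rintro c f ⟨m, hm⟩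
        exact ⟨c • m, fun i => by rw [smul_comm, hm, smul_eq_mul, mul_smul]⟩ }
  obtain ⟨r, hr⟩ := Ideal.exists_pow_le_of_le_radical_of_fg (I := coordIdeal) (J := J) (by
    refine Ideal.span_le.2 ?_
    rintro _ ⟨j, rfl⟩
    exact ⟨k, a j, fun i => h j i⟩) coordIdeal_fg
  have key : ∀ b : originPow I r, ∃ (f : R4) (m : M), Ideal.Quotient.mk I f = b ∧
      ∀ i, (X i : R4) ^ k • m = f • a i := by
    rintro ⟨b, hb⟩
    obtain ⟨f, hf, rfl⟩ := mem_originPow_iff.1 hb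
    obtain ⟨m, hm⟩ := hr hf
    exact ⟨f, m, rfl, hm⟩
  have uniq : ∀ (f f' : R4) (m m' : M), Ideal.Quotient.mk I f = Ideal.Quotient.mk I f' →
      (∀ i, (X i : R4) ^ k • m = f • a i) → (∀ i, (X i : R4) ^ k • m' = f' • a i) → m = m' := by
    intro f f' m m' hff hm hm'
    rw [← sub_eq_zero]
    refine hM k _ fun i => ?_
    rw [smul_sub, hm, hm', ← sub_smul]
    exact IsModuleOn.smul_eq_zero (I := I) _ (Ideal.Quotient.eq.1 hff) _
  choose F g hF hg using key
  let G : PowHom I M r :=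
    { toFun := g
      map_add' := fun b c => uniq _ (F b + F c) _ _
        (by rw [map_add, hF, hF, hF]; rfl) (hg _)
        (fun i => by rw [smul_add, hg, hg, add_smul])
      map_smul' := fun e b => uniq _ (e * F b) _ _
        (by rw [hF, map_mul, hF]; rfl) (hg _)
        (fun i => by rw [RingHom.id_apply, smul_comm, hg, mul_smul]) }
  refine ⟨of I r G, fun i => ?_⟩
  rw [canonical_apply, ← map_smul, of_eq_of]
  refine ⟨r, le_rfl, Nat.zero_le _, ?_⟩
  ext b
  have h1 : (X i : R4) ^ k • g b = mulBy I (a i) (b : R4 ⧸ I) := by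
    rw [hg, ← hF]
    rfl
  exact h1

theorem map_canonical [IsModuleOn I M] [IsModuleOn I N] (φ : M →ₗ[R4] N) (m : M) :
    map I φ (canonical I M m) = canonical I N (φ m) := by
  rw [canonical_apply, canonical_apply, map_of]
  congr 1
  ext ⟨b, hb⟩
  obtain ⟨f, rfl⟩ := Ideal.Quotient.mk_surjective b
  exact map_smul φ f m

theorem map_injective {φ : M →ₗ[R4] N} (hφ : Function.Injective φ) :
    Function.Injective (map I φ) := by
  rw [injective_iff_map_eq_zero]
  intro x hx
  obtain ⟨r, g, rfl⟩ := exists_of x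
  rw [map_of, of_eq_zero_iff] at hx
  obtain ⟨s, hs, h⟩ := hx
  refine (of_eq_zero_iff g).2 ⟨s, hs, ?_⟩
  ext b
  apply hφ
  rw [LinearMap.zero_apply, map_zero]
  exact LinearMap.congr_fun h b

theorem map_exact (T : Submodule R4 M) : Function.Exact (map I T.subtype) (map I T.mkQ) := by
  intro x
  constructor
  · intro hx
    obtain ⟨r, g, rfl⟩ := exists_of x
    rw [map_of, of_eq_zero_iff] at hx
    obtain ⟨s, hs, h⟩ := hx
    refine ⟨of I s ((powRestrict I M r s hs g).codRestrict T fun b => ?_), ?_⟩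
    · rw [← Submodule.Quotient.mk_eq_zero]
      exact LinearMap.congr_fun h b
    · rw [map_of, of_eq_of]
      exact ⟨s, le_rfl, hs, rfl⟩
  · rintro ⟨y, rfl⟩
    obtain ⟨r, g, rfl⟩ := exists_of y
    rw [map_of, map_of, ← map_zero (of (M := M ⧸ T) I r)]
    congr 1
    ext b
    exact (Submodule.Quotient.mk_eq_zero T).2 (g b).2

/-- If the kernel of `M → M / T` is supported on the coordinate axes, then sections over the
punctured space lift along it: on the overlaps of the sets `x_i ≠ 0` the two modules agree, so any
choice of lifts on these sets is compatible. -/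
theorem map_mkQ_surjective [IsModuleOn I M] {T : Submodule R4 M} (hM : OriginTorsionFree M)
    (hN : OriginTorsionFree (M ⧸ T)) {l : ℕ}
    (hT : ∀ i j, i ≠ j → ∀ m ∈ T, (X i * X j : R4) ^ l • m = 0) :
    Function.Surjective (map I T.mkQ) := by
  intro y
  obtain ⟨r, n, hn⟩ := exists_pow_smul_eq_canonical y
  choose m hm using fun i => T.mkQ_surjective (n i)
  have hcomp : ∀ i j, (X j : R4) ^ (r + l) • (X i : R4) ^ l • m i =
      (X i : R4) ^ (r + l) • (X j : R4) ^ l • m j := by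
    intro i j
    rcases eq_or_ne i j with rfl | hij
    · rfl
    have h1 : (X j : R4) ^ r • m i - (X i : R4) ^ r • m j ∈ T := by
      rw [← Submodule.Quotient.mk_eq_zero, ← Submodule.mkQ_apply, map_sub, map_smul, map_smul, hm,
        hm, sub_eq_zero]
      apply canonical_injective (I := I) hN
      rw [map_smul, map_smul, ← hn, ← hn, smul_comm]
    have h2 := hT i j hij _ h1
    rw [smul_sub, sub_eq_zero, smul_smul, smul_smul] at h2
    rw [smul_smul, smul_smul]
    convert h2 using 2 <;> ring
  obtain ⟨x, hx⟩ := exists_pow_smul_eq (I := I) hM hcomp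
  refine ⟨x, ?_⟩
  rw [← sub_eq_zero]
  refine originTorsionFree hN (r + l) _ fun i => ?_
  rw [smul_sub, ← map_smul, hx, map_canonical, map_smul, hm, map_smul, ← hn, smul_smul, ← pow_add,
    add_comm l r, sub_self]

end LimHom

/-! ### The partitions of the pure part -/

theorem monomial_mem_of_le {J : Ideal R4} {v w : Fin 4 →₀ ℕ} (h : v ≤ w)
    (hv : (monomial v (1 : ℂ) : R4) ∈ J) : (monomial w (1 : ℂ) : R4) ∈ J := by
  have e : (monomial w (1 : ℂ) : R4) = monomial (w - v) 1 * monomial v 1 := by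
    rw [monomial_mul, one_mul, tsub_add_cancel_of_le h]
  rw [e]
  exact J.mul_mem_left _ hv

theorem monomial_mem_of_prod_pow_mem {J : Ideal R4} {S : Finset (Fin 4)} {k : ℕ}
    (h : (∏ i ∈ S, X i : R4) ^ k ∈ J) {v : Fin 4 →₀ ℕ} (hv : ∀ i ∈ S, k ≤ v i) :
    (monomial v (1 : ℂ) : R4) ∈ J := by
  refine J.mem_of_dvd ?_ h
  rw [monomial_eq, C_1, one_mul, Finsupp.prod_fintype _ _ (fun _ => pow_zero _), ← Finset.prod_pow]
  exact (Finset.prod_dvd_prod_of_dvd _ _ fun i hi => pow_dvd_pow _ (hv i hi)).trans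
    (Finset.prod_dvd_prod_of_subset _ _ _ (Finset.subset_univ S))

theorem X_mul_X_pow_mul_monomial (i j : Fin 4) (k : ℕ) (v : Fin 4 →₀ ℕ) :
    ((X i * X j : R4) ^ k) * monomial v (1 : ℂ) =
      monomial (v + Finsupp.single i k + Finsupp.single j k) 1 := by
  rw [mul_pow, X_pow_eq_monomial, X_pow_eq_monomial, monomial_mul, monomial_mul, one_mul, one_mul,
    add_comm v, add_right_comm]

theorem mem_pureIdeal_iff {I : Ideal R4} [IsTorusFixed I] {f : R4} :
    f ∈ pureIdeal I ↔ ∀ i j, i ≠ j → ∃ k : ℕ, (X i * X j : R4) ^ k * f ∈ I := by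
  have h : f ∈ pureIdeal I ↔ Ideal.Quotient.mk I f ∈ torsion 1 (R4 ⧸ I) := Iff.rfl
  rw [h, mem_torsion_one_iff]
  simp only [smul_mk_eq_mk_mul, Ideal.Quotient.eq_zero_iff_mem]

theorem isMonomialIdeal_pureIdeal (I : Ideal R4) [IsTorusFixed I] :
    IsMonomialIdeal (pureIdeal I) {v | (monomial v (1 : ℂ) : R4) ∈ pureIdeal I} :=
  isMonomialIdeal_of_torusFixed fun t _ hf =>
    IsTorusFixed.smul_mem (N := torsion 1 (R4 ⧸ I)) t _ hf

/-- The set of exponents `(i_a, i_b)` such that no monomial with these exponents lies in `J`: the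
partition along the generic point of the plane `x_a = x_b = 0`. -/
def planePartition (J : Ideal R4) (p : CoordPair) : Set (ℕ × ℕ) :=
  {x | ∀ v : Fin 4 →₀ ℕ, v p.1.1 = x.1 → v p.1.2 = x.2 → (monomial v (1 : ℂ) : R4) ∉ J}

theorem isLowerSet_planePartition (J : Ideal R4) (p : CoordPair) :
    IsLowerSet (planePartition J p) := by
  rintro ⟨a, b⟩ ⟨a', b'⟩ hle hab v hv1 hv2 hv
  have hp : p.1.1 ≠ p.1.2 := p.2.ne
  have h1 : a' ≤ a := hle.1
  have h2 : b' ≤ b := hle.2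
  refine hab (v + Finsupp.single p.1.1 (a - a') + Finsupp.single p.1.2 (b - b')) ?_ ?_
    (monomial_mem_of_le ?_ hv)
  · simp [hv1, hp, h1]
  · simp [hv2, hp.symm, h2]
  · rw [add_assoc]; exact le_self_add

/-- The exponent with the given entries at the two coordinates of `p` and with the entry `k` at the
other two. -/
noncomputable def planeExponent (p : CoordPair) (a b k : ℕ) : Fin 4 →₀ ℕ :=
  Finsupp.equivFunOnFinite.symm fun i => if i = p.1.1 then a else if i = p.1.2 then b else k

theorem planeExponent_fst (p : CoordPair) (a b k : ℕ) : planeExponent p a b k p.1.1 = a := by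
  simp [planeExponent]

theorem planeExponent_snd (p : CoordPair) (a b k : ℕ) : planeExponent p a b k p.1.2 = b := by
  simp [planeExponent, p.2.ne']

theorem planeExponent_of_ne (p : CoordPair) (a b k : ℕ) {i : Fin 4} (h1 : i ≠ p.1.1)
    (h2 : i ≠ p.1.2) : planeExponent p a b k i = k := by
  simp [planeExponent, h1, h2]

theorem exists_prod_pow_mem {I : Ideal R4} [hI : IsTorusFixed I] {i : ℕ}
    (hdim : ringKrullDim (R4 ⧸ I) ≤ i) {S : Finset (Fin 4)} (hS : i < S.card) :
    ∃ k : ℕ, (∏ j ∈ S, X j : R4) ^ k ∈ I :=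
  prod_pow_mem_of_torusFixed (fun t f hf => hI.smul_mem t f hf) (not_le_ker_restrictCoord hdim hS)

theorem finite_planePartition {I : Ideal R4} [IsTorusFixed I]
    (hdim : ringKrullDim (R4 ⧸ I) ≤ (2 : ℕ)) (p : CoordPair) : (planePartition I p).Finite := by
  obtain ⟨c, d, hcd, hc1, hc2, hd1, hd2⟩ := exists_complementary p
  obtain ⟨k, hk⟩ := exists_prod_pow_mem (S := {p.1.1, c, d}) hdim (by
    rw [Finset.card_insert_of_notMem (by simp [hc1.symm, hd1.symm]), Finset.card_pair hcd]
    norm_num)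
  obtain ⟨l, hl⟩ := exists_prod_pow_mem (S := {p.1.2, c, d}) hdim (by
    rw [Finset.card_insert_of_notMem (by simp [hc2.symm, hd2.symm]), Finset.card_pair hcd]
    norm_num)
  refine ((Set.finite_Iio k).prod (Set.finite_Iio l)).subset ?_
  rintro ⟨a, b⟩ hab
  constructor
  · by_contra h
    have h' : k ≤ a := not_lt.1 h
    refine hab (planeExponent p a b k) (planeExponent_fst ..) (planeExponent_snd ..)
      (monomial_mem_of_prod_pow_mem hk ?_)
    simp [planeExponent_fst, planeExponent_of_ne, hc1, hc2, hd1, hd2, h']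
  · by_contra h
    have h' : l ≤ b := not_lt.1 h
    refine hab (planeExponent p a b l) (planeExponent_fst ..) (planeExponent_snd ..)
      (monomial_mem_of_prod_pow_mem hl ?_)
    simp [planeExponent_snd, planeExponent_of_ne, hc1, hc2, hd1, hd2, h']

theorem exists_pair_of_ne {i j : Fin 4} (hij : i ≠ j) :
    ∃ p : CoordPair, ∀ l, l = p.1.1 ∨ l = p.1.2 ∨ l = i ∨ l = j := by
  revert i j; decide

theorem pureIdeal_eq_unionIdeal (I : Ideal R4) [IsTorusFixed I] :
    pureIdeal I = unionIdeal Set.univ (planePartition I) := by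
  have hm := isMonomialIdeal_unionIdeal Set.univ (isLowerSet_planePartition I)
  refine (isMonomialIdeal_pureIdeal I).ext hm fun v => ?_
  rw [hm.monomial_mem_iff, mem_pureIdeal_iff]
  simp only [X_mul_X_pow_mul_monomial]
  constructor
  · intro h p _ hp
    obtain ⟨c, d, hcd, hc1, hc2, hd1, hd2⟩ := exists_complementary p
    obtain ⟨k, hk⟩ := h c d hcd
    exact hp _ (by simp [hc1.symm, hd1.symm]) (by simp [hc2.symm, hd2.symm]) hk
  · intro h i j hij
    obtain ⟨p, hp⟩ := exists_pair_of_ne hij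
    have h1 : ¬ ∀ w : Fin 4 →₀ ℕ, w p.1.1 = v p.1.1 → w p.1.2 = v p.1.2 →
      (monomial w (1 : ℂ) : R4) ∉ I := h p (Set.mem_univ p)
    push Not at h1
    obtain ⟨w, hw1, hw2, hw⟩ := h1
    refine ⟨w i + w j, monomial_mem_of_le (fun l => ?_) hw⟩
    simp only [Finsupp.add_apply]
    rcases hp l with rfl | rfl | rfl | rfl
    · omega
    · omega
    · rw [Finsupp.single_eq_same]; omega
    · rw [Finsupp.single_eq_same]; omega

/-- The partitions are determined by the ideal of the union: far out on the plane of `p`, the other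
thickened planes are not met. -/
theorem planePartition_unionIdeal {lam : CoordPair → Set (ℕ × ℕ)}
    (hlam : ∀ p, IsFinitePartition (lam p)) (p : CoordPair) :
    planePartition (unionIdeal Set.univ lam) p = lam p := by
  have hm := isMonomialIdeal_unionIdeal Set.univ fun p => (hlam p).2
  obtain ⟨⟨k₁, k₂⟩, hk⟩ := (Set.finite_iUnion fun p => (hlam p).1).bddAbove
  ext ⟨a, b⟩
  constructor
  · intro h
    by_contra hab
    refine h (planeExponent p a b (k₁ + k₂ + 1)) (planeExponent_fst ..) (planeExponent_snd ..) ?_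
    rw [hm.monomial_mem_iff]
    intro q _ hq
    have hle := hk (Set.mem_iUnion.2 ⟨q, hq⟩)
    have h1 : planeExponent p a b (k₁ + k₂ + 1) q.1.1 ≤ k₁ := hle.1
    have h2 : planeExponent p a b (k₁ + k₂ + 1) q.1.2 ≤ k₂ := hle.2
    have e1 : q.1.1 = p.1.1 ∨ q.1.1 = p.1.2 := by
      by_contra! hne
      rw [planeExponent_of_ne p _ _ _ hne.1 hne.2] at h1
      omega
    have e2 : q.1.2 = p.1.1 ∨ q.1.2 = p.1.2 := by
      by_contra! hne
      rw [planeExponent_of_ne p _ _ _ hne.1 hne.2] at h2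
      omega
    have hqp : q = p := by
      have hq' := q.2
      have hp' := p.2
      apply Subtype.ext
      apply Prod.ext
      · grind
      · grind
    subst hqp
    rw [planeExponent_fst, planeExponent_snd] at hq
    exact hab hq
  · rintro hab v rfl rfl hv
    exact (hm.monomial_mem_iff v).1 hv p (Set.mem_univ p) hab

theorem existsUnique_isPureData {I : Ideal R4} [IsTorusFixed I]
    (hdim : ringKrullDim (R4 ⧸ I) ≤ (2 : ℕ)) :
    ∃! lam : CoordPair → Set (ℕ × ℕ), IsPureData I lam := by
  refine ⟨planePartition I, ⟨fun p => ⟨finite_planePartition hdim p,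
    isLowerSet_planePartition I p⟩, pureIdeal_eq_unionIdeal I⟩, ?_⟩
  rintro mu ⟨hmu, hmu'⟩
  funext p
  have h : ∀ p, IsFinitePartition (planePartition I p) := fun p =>
    ⟨finite_planePartition hdim p, isLowerSet_planePartition I p⟩
  rw [← planePartition_unionIdeal hmu, ← hmu', pureIdeal_eq_unionIdeal,
    planePartition_unionIdeal h]

/-! ### The exact sequence of sections over the punctured space -/

theorem originTorsionFree_pureSheaf (I : Ideal R4) [IsTorusFixed I] :
    OriginTorsionFree (PureSheaf I) := by
  intro k x hx
  obtain ⟨m, rfl⟩ := Submodule.Quotient.mk_surjective _ x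
  rw [Submodule.Quotient.mk_eq_zero, mem_torsion_one_iff]
  intro i j hij
  have h1 : (X i : R4) ^ k • m ∈ torsion 1 (R4 ⧸ I) := by
    rw [← Submodule.Quotient.mk_eq_zero]
    exact hx i
  obtain ⟨l, hl⟩ := mem_torsion_one_iff.1 h1 i j hij
  refine ⟨k + l, ?_⟩
  have e : (X i * X j : R4) ^ (k + l) = X j ^ k * ((X i * X j) ^ l * X i ^ k) := by ring
  rw [e, mul_smul, mul_smul, hl, smul_zero]

theorem map_mkQ_torsion_one_surjective {I : Ideal R4} [IsTorusFixed I]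
    (hT0 : torsion 0 (R4 ⧸ I) = ⊥) :
    Function.Surjective (LimHom.map I (torsion 1 (R4 ⧸ I)).mkQ) := by
  have h : ∀ i j : Fin 4, ∃ l : ℕ, i ≠ j → ∀ m ∈ torsion 1 (R4 ⧸ I),
      (X i * X j : R4) ^ l • m = 0 := by
    intro i j
    by_cases hij : i = j
    · exact ⟨0, fun h => absurd hij h⟩
    obtain ⟨k, hk⟩ := exists_prod_pow_smul_eq_zero (M := R4 ⧸ I) (i := 1) (S := {i, j})
      (by rw [Finset.card_pair hij]; norm_num)
    rw [Finset.prod_pair hij] at hk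
    exact ⟨k, fun _ => hk⟩
  choose l hl using h
  refine LimHom.map_mkQ_surjective (l := ∑ i, ∑ j, l i j) (originTorsionFree_of_torsion_zero hT0)
    (originTorsionFree_pureSheaf I) fun i j hij m hm => pow_smul_eq_zero_of_le ?_ (hl i j hij m hm)
  exact (Finset.single_le_sum (f := fun j => l i j) (fun _ _ => Nat.zero_le _)
    (Finset.mem_univ j)).trans (Finset.single_le_sum (f := fun i => ∑ j, l i j)
    (fun _ _ => Nat.zero_le _) (Finset.mem_univ i))

/-! ### The difference map -/

/-- The diagonal torus action on a product of equivariant modules. -/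
noncomputable instance {M N : Type*} [AddCommGroup M] [Module R4 M] [TorusModule M]
    [AddCommGroup N] [Module R4 N] [TorusModule N] : TorusModule (M × N) where
  smul_ring_smul t f m := Prod.ext (TorusModule.smul_ring_smul t f m.1)
    (TorusModule.smul_ring_smul t f m.2)

theorem torus_smul_one (t : Torus) (J : Ideal R4) [IsTorusFixed J] : t • (1 : R4 ⧸ J) = 1 :=
  congrArg (Ideal.Quotient.mk J) (smul_one t)

section Difference

variable (J K : Ideal R4)

theorem differenceMap_mk (f g : R4) :
    differenceMap J K (Ideal.Quotient.mk J f, Ideal.Quotient.mk K g) =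
      Ideal.Quotient.mk (J ⊔ K) (f - g) := rfl

theorem differenceMap_surjective : Function.Surjective (differenceMap J K) := by
  intro w
  obtain ⟨f, rfl⟩ := Ideal.Quotient.mk_surjective w
  exact ⟨(Ideal.Quotient.mk J f, Ideal.Quotient.mk K 0), by rw [differenceMap_mk, sub_zero]⟩

variable {J K} in
theorem smul_one_one_eq_zero_iff {c : R4} : c • ((1, 1) : (R4 ⧸ J) × (R4 ⧸ K)) = 0 ↔ c ∈ J ⊓ K := by
  have h : c • ((1, 1) : (R4 ⧸ J) × (R4 ⧸ K)) =
      (Ideal.Quotient.mk J (c * 1), Ideal.Quotient.mk K (c * 1)) := rfl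
  rw [h, Prod.mk_eq_zero, Ideal.Quotient.eq_zero_iff_mem, Ideal.Quotient.eq_zero_iff_mem, mul_one,
    Submodule.mem_inf]

variable {J K} in
theorem differenceMap_eq_zero_iff {x : (R4 ⧸ J) × (R4 ⧸ K)} :
    differenceMap J K x = 0 ↔ ∃ c : R4, x = c • (1, 1) := by
  constructor
  · obtain ⟨x, y⟩ := x
    obtain ⟨f, rfl⟩ := Ideal.Quotient.mk_surjective x
    obtain ⟨g, rfl⟩ := Ideal.Quotient.mk_surjective y
    rw [differenceMap_mk, Ideal.Quotient.eq_zero_iff_mem]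
    intro h
    obtain ⟨a, ha, b, hb, hab⟩ := Submodule.mem_sup.1 h
    refine ⟨f - a, Prod.ext ?_ ?_⟩
    · change Ideal.Quotient.mk J f = Ideal.Quotient.mk J ((f - a) * 1)
      rw [Ideal.Quotient.eq]
      simpa using ha
    · change Ideal.Quotient.mk K g = Ideal.Quotient.mk K ((f - a) * 1)
      rw [Ideal.Quotient.eq]
      have e : g - (f - a) * 1 = -b := by linear_combination hab
      rw [e]
      exact K.neg_mem hb
  · rintro ⟨c, rfl⟩
    rw [map_smul, differenceMap_one, smul_zero]

theorem differenceMap_torus_smul [IsTorusFixed J] [IsTorusFixed K] [IsTorusFixed (J ⊔ K)]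
    (t : Torus) (x : (R4 ⧸ J) × (R4 ⧸ K)) :
    differenceMap J K (t • x) = t • differenceMap J K x := by
  obtain ⟨x, y⟩ := x
  obtain ⟨f, rfl⟩ := Ideal.Quotient.mk_surjective x
  obtain ⟨g, rfl⟩ := Ideal.Quotient.mk_surjective y
  rw [differenceMap_mk]
  exact congrArg (Ideal.Quotient.mk (J ⊔ K)) (smul_sub t f g).symm

variable {J K} in
/-- A section that generates away from the origin has the same property in the image under the
difference map, so that this image is supported at the origin. -/
theorem differenceMap_mem_torsion_zero {F : Type*} [AddCommGroup F] [Module R4 F] {s : F}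
    (hs : ∀ f : F, ∀ i, ∃ (k : ℕ) (c : R4), (X i : R4) ^ k • f = c • s)
    {ψ : F →ₗ[R4] (R4 ⧸ J) × (R4 ⧸ K)} (hψ : ψ s = (1, 1)) (f : F) :
    differenceMap J K (ψ f) ∈ torsion 0 (R4 ⧸ (J ⊔ K)) := by
  refine mem_torsion_zero_of_forall_X_pow fun i => ?_
  obtain ⟨k, c, hc⟩ := hs f i
  exact ⟨k, by rw [← map_smul, ← map_smul, hc, map_smul, hψ, map_smul, differenceMap_one,
    smul_zero]⟩

variable {J K} in
/-- A preimage of an element supported at the origin is, away from the origin, a multiple of the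
section `(1, 1)`. -/
theorem exists_pow_smul_eq_smul_one_one [IsTorusFixed (J ⊔ K)] {w : R4 ⧸ (J ⊔ K)}
    (hw : w ∈ torsion 0 (R4 ⧸ (J ⊔ K))) : ∃ (x : (R4 ⧸ J) × (R4 ⧸ K)) (k : ℕ) (c : Fin 4 → R4),
      differenceMap J K x = w ∧ ∀ i, (X i : R4) ^ k • x = c i • (1, 1) := by
  obtain ⟨x, rfl⟩ := differenceMap_surjective J K w
  obtain ⟨k, hk⟩ := exists_uniform_pow
    (p := fun i k => (X i : R4) ^ k • differenceMap J K x = 0)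
    (fun _ _ _ h => pow_smul_eq_zero_of_le h) (mem_torsion_zero_iff.1 hw)
  choose c hc using fun i => differenceMap_eq_zero_iff.1 ((map_smul _ _ _).trans (hk i))
  exact ⟨x, k, c, rfl, hc⟩

end Difference

/-- Maps into a module without torsion at the origin are equivariant as soon as the section that
generates the source away from the origin, and its image, are invariant. Here `σ` is the action of
`t` on the source. -/
theorem OriginTorsionFree.map_semilinear {F M : Type*} [AddCommGroup F] [Module R4 F]
    [AddCommGroup M] [Module R4 M] [TorusModule M] (hM : OriginTorsionFree M) {s : F}
    (hs : ∀ f : F, ∀ i, ∃ (k : ℕ) (c : R4), (X i : R4) ^ k • f = c • s) (ψ : F →ₗ[R4] M)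
    (t : Torus) (hψ : t • ψ s = ψ s) (σ : F →+ F)
    (hσ : ∀ (f : R4) (m : F), σ (f • m) = (t • f) • σ m) (hσs : σ s = s) (m : F) :
    ψ (σ m) = t • ψ m := by
  let φ : F →ₗ[R4] M :=
    { toFun := fun m => t⁻¹ • ψ (σ m)
      map_add' := fun a b => by rw [map_add, map_add, smul_add]
      map_smul' := fun f a => by
        rw [hσ, map_smul, TorusModule.smul_ring_smul, inv_smul_smul, RingHom.id_apply] }
  have h : φ = ψ := hM.hom_ext hs (by
    change t⁻¹ • ψ (σ s) = ψ s
    rw [hσs, inv_smul_eq_iff, hψ])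
  have h1 : t⁻¹ • ψ (σ m) = ψ m := LinearMap.congr_fun h m
  rwa [inv_smul_eq_iff] at h1

theorem unionIdeal_univ (lam : CoordPair → Set (ℕ × ℕ)) :
    unionIdeal Set.univ lam = unionIdeal pairsA lam ⊓ unionIdeal pairsB lam := by
  ext f
  simp only [unionIdeal, Submodule.mem_inf, Submodule.mem_iInf]
  refine ⟨fun h => ⟨fun p _ => h p trivial, fun p _ => h p trivial⟩, fun h p _ => ?_⟩
  by_cases hp : p.1.2 = 3
  · exact h.2 p hp
  · exact h.1 p hp

/-! ### The local cohomology of the pure part -/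

section LimQuot

variable {I : Ideal R4}

/-- The section `1` of the structure sheaf of the pure part. -/
noncomputable def pureOne (I : Ideal R4) : PureSheaf I :=
  (torsion 1 (R4 ⧸ I)).mkQ (Ideal.Quotient.mk I 1)

theorem exists_smul_pureOne (x : PureSheaf I) : ∃ c : R4, x = c • pureOne I := by
  obtain ⟨y, rfl⟩ := Submodule.mkQ_surjective _ x
  obtain ⟨f, rfl⟩ := Ideal.Quotient.mk_surjective y
  refine ⟨f, ?_⟩
  rw [pureOne, ← map_smul, smul_mk_eq_mk_mul, mul_one]

theorem smul_pureOne_eq_zero_iff {c : R4} : c • pureOne I = 0 ↔ c ∈ pureIdeal I := by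
  rw [pureOne, ← map_smul, smul_mk_eq_mk_mul, mul_one, Submodule.mkQ_apply,
    Submodule.Quotient.mk_eq_zero]
  rfl

theorem exists_pow_smul_eq_smul_canonical (x : LimHom I (PureSheaf I)) (i : Fin 4) :
    ∃ (k : ℕ) (c : R4), (X i : R4) ^ k • x = c • LimHom.canonical I _ (pureOne I) := by
  obtain ⟨r, n, hn⟩ := LimHom.exists_pow_smul_eq_canonical x
  obtain ⟨c, hc⟩ := exists_smul_pureOne (n i)
  exact ⟨r, c, by rw [hn, hc, map_smul]⟩

theorem limQuot_equivariantlyIso [IsTorusFixed I] {lam : CoordPair → Set (ℕ × ℕ)}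
    (hlam : IsPureData I lam) : EquivariantlyIso (LimQuot I (PureSheaf I)) (TorsionW lam) := by
  have hlow : ∀ p, IsLowerSet (lam p) := fun p => (hlam.1 p).2
  have hJ : pureIdeal I = unionIdeal pairsA lam ⊓ unionIdeal pairsB lam :=
    hlam.2.trans (unionIdeal_univ lam)
  have hM := (saturated_pairsA hlow).prod (saturated_pairsB hlow)
  have hP := originTorsionFree_pureSheaf I
  have hL := LimHom.originTorsionFree (I := I) hP
  have hinj := LimHom.canonical_injective (I := I) hP
  have hann : ∀ c : R4, c • LimHom.canonical I _ (pureOne I) = 0 ↔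
      c • ((1, 1) : (R4 ⧸ unionIdeal pairsA lam) × (R4 ⧸ unionIdeal pairsB lam)) = 0 := by
    intro c
    rw [smul_one_one_eq_zero_iff, ← hJ, ← smul_pureOne_eq_zero_iff, ← map_smul,
      map_eq_zero_iff _ hinj]
  have hs := exists_pow_smul_eq_smul_canonical (I := I)
  obtain ⟨ψ, hψ⟩ := hM.exists_extension hs fun c => (hann c).1
  have hψinj : Function.Injective ψ := hL.injective hs ψ fun c h => (hann c).2 (by rwa [hψ] at h)
  have hψt : ∀ (t : Torus) (x : LimHom I (PureSheaf I)), ψ (t • x) = t • ψ x := by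
    intro t x
    refine hM.1.map_semilinear hs ψ t ?_ (actHom _ t)
      (fun f m => TorusModule.smul_ring_smul t f m) ?_ x
    · rw [hψ]
      exact Prod.ext (torus_smul_one t _) (torus_smul_one t _)
    · refine (torus_smul_canonical I t _).trans (congrArg _ ?_)
      exact congrArg (torsion 1 (R4 ⧸ I)).mkQ (torus_smul_one t I)
  let ξ : LimHom I (PureSheaf I) →ₗ[R4] (R4 ⧸ idealW lam) := (differenceMap _ _).comp ψ
  have hker : LinearMap.range (LimHom.canonical I (PureSheaf I)) = LinearMap.ker ξ := by
    ext x
    rw [LinearMap.mem_ker, LinearMap.comp_apply, differenceMap_eq_zero_iff]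
    constructor
    · rintro ⟨m, rfl⟩
      obtain ⟨c, rfl⟩ := exists_smul_pureOne m
      exact ⟨c, by rw [map_smul, map_smul, hψ]⟩
    · rintro ⟨c, hc⟩
      rw [← hψ, ← map_smul] at hc
      exact ⟨c • pureOne I, by rw [hψinj hc, map_smul]⟩
  have hrange : LinearMap.range ξ = torsion 0 (R4 ⧸ idealW lam) := by
    refine le_antisymm ?_ fun w hw => ?_
    · rintro _ ⟨x, rfl⟩
      exact differenceMap_mem_torsion_zero hs hψ x
    · obtain ⟨a, k, c, hac, hc⟩ := exists_pow_smul_eq_smul_one_one hw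
      obtain ⟨x, hx⟩ := LimHom.exists_pow_smul_eq (I := I) hP (k := k)
        (a := fun i => c i • pureOne I) fun i j => by
          rw [smul_smul, smul_smul, ← sub_eq_zero, ← sub_smul, smul_pureOne_eq_zero_iff, hJ,
            ← smul_one_one_eq_zero_iff, sub_smul, mul_smul, mul_smul, ← hc, ← hc, smul_comm,
            sub_self]
      refine ⟨x, Eq.trans (congrArg (differenceMap _ _) ?_) hac⟩
      rw [← sub_eq_zero]
      refine hM.1 k _ fun i => ?_
      rw [smul_sub, ← map_smul, hx, map_smul, map_smul, hψ, hc, sub_self]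
  refine ⟨(Submodule.quotEquivOfEq _ _ hker).trans
    (ξ.quotKerEquivRange.trans (LinearEquiv.ofEq _ _ hrange)), fun t x => ?_⟩
  obtain ⟨y, rfl⟩ := Submodule.Quotient.mk_surjective _ x
  apply Subtype.ext
  change ξ (t • y) = t • ξ y
  rw [LinearMap.comp_apply, hψt, differenceMap_torus_smul]
  rfl

end LimQuot

/-! ### Finiteness of the fixed quotients -/

/-- A coherent equivariant module of dimension zero has finite length. -/
theorem length_torsion_zero_ne_top {M : Type*} [AddCommGroup M] [Module R4 M] [TorusModule M]
    [IsNoetherian R4 M] (K : Submodule R4 (torsion 0 M)) :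
    Module.length R4 (torsion 0 M ⧸ K) ≠ ⊤ := by
  have hdim : Module.supportDim R4 (torsion 0 M) ≤ ((0 : ℕ) : WithBot ℕ∞) := by
    refine supportDim_le_of_prod_pow_smul_eq_zero fun S hS => ?_
    obtain ⟨k, hk⟩ := exists_prod_pow_smul_eq_zero (M := M) (i := 0) (S := S) (by omega)
    exact ⟨k, fun m => Subtype.ext (hk m m.2)⟩
  rw [Module.supportDim_eq_ringKrullDim_quotient_annihilator] at hdim
  let J := Module.annihilator R4 (torsion 0 M)
  have : Ring.KrullDimLE 0 (R4 ⧸ J) := (Order.krullDimLE_iff 0 _).2 hdim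
  have : IsArtinianRing (R4 ⧸ J) := isArtinianRing_iff_krullDimLE_zero.2 this
  have ht : Module.IsTorsionBySet R4 (torsion 0 M) (J : Set R4) :=
    fun m f => Module.mem_annihilator.1 f.2 m
  let _ := ht.module
  have : IsScalarTower R4 (R4 ⧸ J) (torsion 0 M) := ht.isScalarTower
  have : Module.Finite (R4 ⧸ J) (torsion 0 M) := Module.Finite.of_restrictScalars_finite R4 _ _
  have : IsArtinian (R4 ⧸ J) (torsion 0 M) := inferInstance
  have : IsArtinian R4 (torsion 0 M) :=
    (isArtinian_of_surjective_algebraMap (R := R4 ⧸ J) (S := R4) Ideal.Quotient.mk_surjective)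
  exact Module.length_ne_top

/-- Between two monomial ideals whose quotient is killed by powers of all coordinates there are only
finitely many monomials. -/
theorem finite_setOf_monomial_mem_notMem {J L : Ideal R4} {D : Set (Fin 4 →₀ ℕ)}
    (hL : IsMonomialIdeal L D) {k : ℕ} (hk : ∀ f ∈ L, ∀ i, X i ^ k * f ∈ J) :
    {v : Fin 4 →₀ ℕ | (monomial v (1 : ℂ) : R4) ∈ L ∧ (monomial v (1 : ℂ) : R4) ∉ J}.Finite := by
  classical
  obtain ⟨G, hG⟩ := IsNoetherian.noetherian L
  let W : Finset (Fin 4 →₀ ℕ) := G.biUnion fun g => g.support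
  have hW : ∀ w ∈ W, (monomial w (1 : ℂ) : R4) ∈ L := by
    intro w hw
    obtain ⟨g, hg, hw⟩ := Finset.mem_biUnion.1 hw
    rw [hL.monomial_mem_iff]
    exact (hL g).1 (hG ▸ Submodule.subset_span hg) w hw
  have hdec : ∀ f ∈ L, ∀ v ∈ f.support, ∃ u, ∃ w ∈ W, u + w = v := by
    intro f hf
    rw [← hG] at hf
    induction hf using Submodule.span_induction with
    | mem x hx => exact fun v hv => ⟨0, v, Finset.mem_biUnion.2 ⟨x, hx, hv⟩, zero_add v⟩
    | zero => simp
    | add x y _ _ hx hy =>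
      exact fun v hv => (Finset.mem_union.1 (support_add hv)).elim (hx v) (hy v)
    | smul c x _ hx =>
      intro v hv
      obtain ⟨u, _, v', hv', rfl⟩ := Finset.mem_add.1 (support_mul c x hv)
      obtain ⟨u', w, hw, rfl⟩ := hx v' hv'
      exact ⟨u + u', w, hw, add_assoc _ _ _⟩
  let K : Fin 4 →₀ ℕ := Finsupp.equivFunOnFinite.symm fun _ => k
  refine ((Set.finite_Iic K).image2 (· + ·) W.finite_toSet).subset ?_
  rintro v ⟨hv, hvJ⟩
  obtain ⟨u, w, hw, rfl⟩ := hdec _ hv v (by simp)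
  refine ⟨u, fun i => ?_, w, hw, rfl⟩
  by_contra! hlt
  have hki : k ≤ u i := hlt.le
  refine hvJ (monomial_mem_of_le (v := Finsupp.single i k + w) ?_ ?_)
  · gcongr
    exact Finsupp.single_le_iff.2 hki
  · have h := hk _ (hW w hw) i
    rwa [X_pow_eq_monomial, monomial_mul, one_mul] at h

/-- The preimage in the coordinate ring of a submodule of `T_0(R / J)`. -/
noncomputable def preimageIdeal (J : Ideal R4) (K : Submodule R4 (torsion 0 (R4 ⧸ J))) : Ideal R4 :=
  (K.map (torsion 0 (R4 ⧸ J)).subtype).comap (Submodule.mkQ J)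

theorem preimageIdeal_injective (J : Ideal R4) : Function.Injective (preimageIdeal J) :=
  (Submodule.comap_injective_of_surjective (Submodule.mkQ_surjective J)).comp
    (Submodule.map_injective_of_injective (Submodule.subtype_injective _))

theorem mem_preimageIdeal_of_mem {J : Ideal R4} (K : Submodule R4 (torsion 0 (R4 ⧸ J))) {f : R4}
    (hf : f ∈ J) : f ∈ preimageIdeal J K := by
  have h : Submodule.mkQ J f = 0 := Ideal.Quotient.eq_zero_iff_mem.2 hf
  rw [preimageIdeal, Submodule.mem_comap, h]
  exact zero_mem _

theorem mk_mem_torsion_of_mem_preimageIdeal {J : Ideal R4} {K : Submodule R4 (torsion 0 (R4 ⧸ J))}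
    {f : R4} (hf : f ∈ preimageIdeal J K) : Ideal.Quotient.mk J f ∈ torsion 0 (R4 ⧸ J) := by
  obtain ⟨x, _, hx⟩ := hf
  exact hx ▸ x.2

theorem isMonomialIdeal_preimageIdeal {J : Ideal R4} [IsTorusFixed J]
    (K : Submodule R4 (torsion 0 (R4 ⧸ J))) [hK : IsTorusFixed K] :
    IsMonomialIdeal (preimageIdeal J K)
      {v | (monomial v (1 : ℂ) : R4) ∈ preimageIdeal J K} := by
  refine isMonomialIdeal_of_torusFixed fun t f hf => ?_
  obtain ⟨x, hx, hxf⟩ := hf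
  exact ⟨t • x, hK.smul_mem t x hx, congrArg (fun y => t • y) hxf⟩

/-- There are finitely many torus-fixed submodules of `T_0(R / J)`: such a submodule is determined
by the finitely many monomials that it contains. -/
theorem finite_torusFixed_submodules (J : Ideal R4) [IsTorusFixed J] :
    Finite {K : Submodule R4 (torsion 0 (R4 ⧸ J)) // IsTorusFixed K} := by
  have : IsTorusFixed (⊤ : Submodule R4 (torsion 0 (R4 ⧸ J))) := ⟨fun _ _ _ => trivial⟩
  have hk : ∀ i, ∃ k : ℕ, ∀ f ∈ preimageIdeal J ⊤, (X i : R4) ^ k * f ∈ J := by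
    intro i
    obtain ⟨k, hk⟩ := exists_prod_pow_smul_eq_zero (M := R4 ⧸ J) (i := 0) (S := {i}) (by simp)
    rw [Finset.prod_singleton] at hk
    exact ⟨k, fun f hf => Ideal.Quotient.eq_zero_iff_mem.1
      (hk _ (mk_mem_torsion_of_mem_preimageIdeal hf))⟩
  obtain ⟨k, hk⟩ := exists_uniform_pow
    (p := fun i k => ∀ f ∈ preimageIdeal J ⊤, (X i : R4) ^ k * f ∈ J)
    (fun i k l hkl h f hf => by
      rw [← Nat.sub_add_cancel hkl, pow_add, mul_assoc]
      exact J.mul_mem_left _ (h f hf)) hk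
  let B := {v : Fin 4 →₀ ℕ | (monomial v (1 : ℂ) : R4) ∈ preimageIdeal J ⊤ ∧
    (monomial v (1 : ℂ) : R4) ∉ J}
  have hB : B.Finite :=
    finite_setOf_monomial_mem_notMem (isMonomialIdeal_preimageIdeal ⊤) fun f hf i => hk i f hf
  have := hB.to_subtype
  refine Finite.of_injective (fun K : {K : Submodule R4 (torsion 0 (R4 ⧸ J)) // IsTorusFixed K} =>
    {v : B | (monomial (v : Fin 4 →₀ ℕ) (1 : ℂ) : R4) ∈ preimageIdeal J K.1}) ?_
  rintro ⟨K, hK⟩ ⟨L, hL⟩ hKL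
  apply Subtype.ext
  apply preimageIdeal_injective
  refine (isMonomialIdeal_preimageIdeal K).ext (isMonomialIdeal_preimageIdeal L) fun v => ?_
  by_cases hv : v ∈ B
  · exact Set.ext_iff.1 hKL ⟨v, hv⟩
  have htop : ∀ K : Submodule R4 (torsion 0 (R4 ⧸ J)),
      (monomial v (1 : ℂ) : R4) ∈ preimageIdeal J K → (monomial v (1 : ℂ) : R4) ∈ J := by
    intro K hvK
    by_contra hvJ
    exact hv ⟨Submodule.comap_mono (Submodule.map_mono le_top) hvK, hvJ⟩
  exact ⟨fun h => mem_preimageIdeal_of_mem L (htop K h),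
    fun h => mem_preimageIdeal_of_mem K (htop L h)⟩

theorem finite_fixedQuot (J : Ideal R4) [IsTorusFixed J] :
    Finite (Σ m : ℕ, FixedQuot (torsion 0 (R4 ⧸ J)) m) := by
  have := finite_torusFixed_submodules J
  refine Finite.of_injective (fun q : Σ m : ℕ, FixedQuot (torsion 0 (R4 ⧸ J)) m =>
    (⟨q.2.1, q.2.2.1⟩ : {K : Submodule R4 (torsion 0 (R4 ⧸ J)) // IsTorusFixed K})) ?_
  rintro ⟨m, K, hK, hm⟩ ⟨n, L, hL, hn⟩ h
  obtain rfl : K = L := congrArg Subtype.val h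
  obtain rfl : m = n := by
    have := hm.symm.trans hn
    exact_mod_cast this
  rfl

/-! ### `PT₀` pairs -/

section Pairs

variable {I : Ideal R4} {lam : CoordPair → Set (ℕ × ℕ)}

theorem exists_X_pow_smul_pairOf (Q : Submodule R4 (TorsionW lam)) (i : Fin 4) :
    ∃ k : ℕ, ∀ f : (pairOf lam Q).F, ∃ c : R4, (X i : R4) ^ k • f = c • (pairOf lam Q).s := by
  obtain ⟨k, hk⟩ := exists_prod_pow_smul_eq_zero (M := R4 ⧸ idealW lam) (i := 0) (S := {i})
    (by simp)
  rw [Finset.prod_singleton] at hk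
  refine ⟨k, ?_⟩
  rintro ⟨x, w, _, hw⟩
  have h : differenceMap _ _ ((X i : R4) ^ k • x) = 0 := by
    rw [map_smul, ← hw]
    exact hk _ w.2
  obtain ⟨c, hc⟩ := differenceMap_eq_zero_iff.1 h
  exact ⟨c, Subtype.ext hc⟩

theorem annihilator_pairOf (hI : I = unionIdeal pairsA lam ⊓ unionIdeal pairsB lam)
    (Q : Submodule R4 (TorsionW lam)) : Module.annihilator R4 (pairOf lam Q).F = I := by
  ext c
  rw [Module.mem_annihilator, hI]
  constructor
  · intro h
    exact smul_one_one_eq_zero_iff.1 (congrArg Subtype.val (h (pairOf lam Q).s))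
  · rintro ⟨hA, hB⟩ ⟨⟨x, y⟩, hxy⟩
    exact Subtype.ext (Prod.ext (IsModuleOn.smul_eq_zero c hA x) (IsModuleOn.smul_eq_zero c hB y))

theorem isFixedPT0On_pairOf (hdim : ringKrullDim (R4 ⧸ I) = 2)
    (hlow : ∀ p, IsLowerSet (lam p)) (hI : I = unionIdeal pairsA lam ⊓ unionIdeal pairsB lam)
    (Q : Submodule R4 (TorsionW lam)) [hQ : IsTorusFixed Q] : (pairOf lam Q).IsFixedPT0On I := by
  have hM := (saturated_pairsA hlow).prod (saturated_pairsB hlow)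
  let F := (Q.map (torsion 0 (R4 ⧸ idealW lam)).subtype).comap
    (differenceMap (unionIdeal pairsA lam) (unionIdeal pairsB lam))
  have hF : IsTorusFixed F := by
    refine ⟨fun t x hx => ?_⟩
    obtain ⟨w, hw, hwx⟩ := hx
    refine ⟨t • w, hQ.smul_mem t w hw, ?_⟩
    rw [differenceMap_torus_smul, ← hwx]
    rfl
  have hfin : Module.Finite R4 F := Module.Finite.iff_fg.2 (IsNoetherian.noetherian F)
  refine ⟨⟨hfin, ?_, ?_, ?_⟩, fun t => ?_, annihilator_pairOf hI Q⟩
  · change Module.supportDim R4 F = 2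
    rw [Module.supportDim_eq_ringKrullDim_quotient_annihilator]
    exact (congrArg (fun J : Ideal R4 => ringKrullDim (R4 ⧸ J))
      (annihilator_pairOf hI Q)).trans hdim
  · change torsion 0 F = ⊥
    rw [eq_bot_iff]
    intro x hx
    exact (hM.1.of_injective F.subtype F.subtype_injective).eq_zero (mem_torsion_zero_iff.1 hx)
  · refine (supportDim_le_of_prod_pow_smul_eq_zero (i := 0) fun S hS => ?_)
    obtain ⟨i, rfl⟩ := Finset.card_eq_one.1 hS
    obtain ⟨k, hk⟩ := exists_X_pow_smul_pairOf Q i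
    refine ⟨k, fun x => ?_⟩
    obtain ⟨f, rfl⟩ := Submodule.Quotient.mk_surjective _ x
    obtain ⟨c, hc⟩ := hk f
    rw [Finset.prod_singleton, ← Submodule.Quotient.mk_smul, hc, Submodule.Quotient.mk_eq_zero]
    exact Submodule.smul_mem _ _ (Submodule.mem_span_singleton_self _)
  · refine ⟨DistribMulAction.toAddEquiv F t, fun f m =>
      TorusModule.smul_ring_smul (M := F) t f m, ?_⟩
    exact Subtype.ext (Prod.ext (torus_smul_one t _) (torus_smul_one t _))

theorem pairOf_le_of_iso (hlow : ∀ p, IsLowerSet (lam p)) {Q Q' : Submodule R4 (TorsionW lam)}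
    (h : (pairOf lam Q).Iso (pairOf lam Q')) : Q ≤ Q' := by
  have hM := (saturated_pairsA hlow).prod (saturated_pairsB hlow)
  obtain ⟨e, he⟩ := h
  let F := fun Q : Submodule R4 (TorsionW lam) =>
    (Q.map (torsion 0 (R4 ⧸ idealW lam)).subtype).comap
      (differenceMap (unionIdeal pairsA lam) (unionIdeal pairsB lam))
  have hs : ∀ f : (pairOf lam Q).F, ∀ i, ∃ (k : ℕ) (c : R4),
      (X i : R4) ^ k • f = c • (pairOf lam Q).s := by
    intro f i
    obtain ⟨k, hk⟩ := exists_X_pow_smul_pairOf Q i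
    exact ⟨k, hk f⟩
  have key : (F Q).subtype = (F Q').subtype.comp (e : (pairOf lam Q).F →ₗ[R4] (pairOf lam Q').F) :=
    hM.1.hom_ext hs (congrArg (F Q').subtype he).symm
  intro w hw
  obtain ⟨x, hx⟩ := differenceMap_surjective (unionIdeal pairsA lam) (unionIdeal pairsB lam) w
  have h1 : x = (F Q').subtype (e ⟨x, w, hw, hx.symm⟩) :=
    LinearMap.congr_fun key ⟨x, w, hw, hx.symm⟩
  obtain ⟨w', hw', hww⟩ : x ∈ F Q' := h1 ▸ Subtype.prop _
  have h2 : w = w' := Subtype.ext (hx.symm.trans hww.symm)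
  exact h2 ▸ hw'

theorem SheafPair.IsFixedPT0On.exists_pow_smul_eq {p : SheafPair} (hp : p.IsFixedPT0On I) (f : p.F)
    (i : Fin 4) : ∃ (k : ℕ) (c : R4), (X i : R4) ^ k • f = c • p.s := by
  obtain ⟨⟨hfin, -, -, hdim⟩, hfix, -⟩ := hp
  rw [Module.supportDim_eq_ringKrullDim_quotient_annihilator] at hdim
  let J := Module.annihilator R4 (p.F ⧸ Submodule.span R4 {p.s})
  have hmem : ∀ g : R4, g ∈ J ↔ ∀ m : p.F, ∃ c : R4, g • m = c • p.s := by
    intro g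
    rw [Module.mem_annihilator]
    constructor
    · intro h m
      have h1 := h (Submodule.Quotient.mk m)
      rw [← Submodule.Quotient.mk_smul, Submodule.Quotient.mk_eq_zero] at h1
      obtain ⟨c, hc⟩ := Submodule.mem_span_singleton.1 h1
      exact ⟨c, hc.symm⟩
    · intro h x
      obtain ⟨m, rfl⟩ := Submodule.Quotient.mk_surjective _ x
      obtain ⟨c, hc⟩ := h m
      rw [← Submodule.Quotient.mk_smul, hc, Submodule.Quotient.mk_eq_zero]
      exact Submodule.smul_mem _ _ (Submodule.mem_span_singleton_self _)
  have hJ : ∀ (t : Torus), ∀ g ∈ J, t • g ∈ J := by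
    intro t g hg
    rw [hmem] at hg ⊢
    intro m
    obtain ⟨σ, hσ, hσs⟩ := hfix t
    obtain ⟨c, hc⟩ := hg (σ.symm m)
    refine ⟨t • c, ?_⟩
    have h1 := congrArg σ hc
    rwa [hσ, hσ, hσs, σ.apply_symm_apply] at h1
  obtain ⟨k, hk⟩ := prod_pow_mem_of_torusFixed hJ
    (not_le_ker_restrictCoord (i := 0) (S := {i}) hdim (by simp))
  rw [Finset.prod_singleton] at hk
  exact ⟨k, (hmem _).1 hk f⟩

/-- Every torus-fixed `PT₀` pair embeds into `(O_A ⊕ O_B, (1, 1))`, because this module is saturated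
and the section generates away from the origin; the image is the preimage of a submodule of
`T_0(O_W)`. -/
theorem exists_pairOf_iso [IsTorusFixed I]
    (hlow : ∀ p, IsLowerSet (lam p)) (hI : I = unionIdeal pairsA lam ⊓ unionIdeal pairsB lam)
    {p : SheafPair} (hp : p.IsFixedPT0On I) :
    ∃ Q : Submodule R4 (TorsionW lam), IsTorusFixed Q ∧ p.Iso (pairOf lam Q) := by
  have hM := (saturated_pairsA hlow).prod (saturated_pairsB hlow)
  have hs := hp.exists_pow_smul_eq
  have hF := originTorsionFree_of_torsion_zero hp.1.2.2.1
  have hann : ∀ c : R4, c • p.s = 0 ↔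
      c • ((1, 1) : (R4 ⧸ unionIdeal pairsA lam) × (R4 ⧸ unionIdeal pairsB lam)) = 0 := by
    intro c
    rw [smul_one_one_eq_zero_iff, ← hI, ← hp.2.2, Module.mem_annihilator]
    refine ⟨fun h f => hF.eq_zero fun i => ?_, fun h => h p.s⟩
    obtain ⟨k, d, hd⟩ := hs f i
    exact ⟨k, by rw [smul_comm, hd, smul_comm, h, smul_zero]⟩
  obtain ⟨ψ, hψ⟩ := hM.exists_extension hs fun c => (hann c).1
  have hψinj : Function.Injective ψ := hF.injective hs ψ fun c h => (hann c).2 (by rwa [hψ] at h)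
  let Q : Submodule R4 (TorsionW lam) :=
    ((LinearMap.range ψ).map (differenceMap _ _)).comap (torsion 0 (R4 ⧸ idealW lam)).subtype
  let F := (Q.map (torsion 0 (R4 ⧸ idealW lam)).subtype).comap
      (differenceMap (unionIdeal pairsA lam) (unionIdeal pairsB lam))
  have hrange : LinearMap.range ψ = F := by
    ext x
    constructor
    · rintro ⟨f, rfl⟩
      exact ⟨⟨_, differenceMap_mem_torsion_zero hs hψ f⟩, ⟨_, ⟨f, rfl⟩, rfl⟩, rfl⟩
    · rintro ⟨w, ⟨_, ⟨f, rfl⟩, hf⟩, hw⟩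
      have h1 : differenceMap _ _ (x - ψ f) = 0 := by
        rw [map_sub, hf, sub_eq_zero]
        exact hw.symm
      obtain ⟨c, hc⟩ := differenceMap_eq_zero_iff.1 h1
      refine ⟨f + c • p.s, ?_⟩
      rw [map_add, map_smul, hψ, ← hc, add_sub_cancel]
  refine ⟨Q, ⟨fun t w hw => ?_⟩,
    (LinearEquiv.ofInjective ψ hψinj).trans (LinearEquiv.ofEq _ _ hrange), Subtype.ext hψ⟩
  obtain ⟨_, ⟨f, rfl⟩, hf⟩ := hw
  obtain ⟨σ, hσ, hσs⟩ := hp.2.1 t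
  refine ⟨ψ (σ f), ⟨σ f, rfl⟩, ?_⟩
  have hσf : ψ (σ f) = t • ψ f := by
    refine hM.1.map_semilinear hs ψ t ?_ σ.toAddMonoidHom hσ hσs f
    rw [hψ]
    exact Prod.ext (torus_smul_one t _) (torus_smul_one t _)
  rw [hσf, differenceMap_torus_smul, hf]
  rfl

theorem exists_equiv_fixedPT0 [IsTorusFixed I] (hdim : ringKrullDim (R4 ⧸ I) = 2)
    (hlow : ∀ p, IsLowerSet (lam p)) (hI : I = unionIdeal pairsA lam ⊓ unionIdeal pairsB lam) :
    ∃ Φ : (Σ m : ℕ, FixedQuot (TorsionW lam) m) ≃ FixedPT0 I,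
      ∀ (m : ℕ) (q : FixedQuot (TorsionW lam) m),
        ∃ h : (pairOf lam q.kernel).IsFixedPT0On I, Φ ⟨m, q⟩ = FixedPT0.mk _ h := by
  have hpt : ∀ (m : ℕ) (q : FixedQuot (TorsionW lam) m), (pairOf lam q.kernel).IsFixedPT0On I :=
    fun m q => isFixedPT0On_pairOf hdim hlow hI q.kernel (hQ := q.2.1)
  let Φ : (Σ m : ℕ, FixedQuot (TorsionW lam) m) → FixedPT0 I := fun q =>
    FixedPT0.mk _ (hpt q.1 q.2)
  have hinj : Function.Injective Φ := by
    rintro ⟨m, K, hK, hm⟩ ⟨n, L, hL, hn⟩ h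
    have hiso : (pairOf lam K).Iso (pairOf lam L) := Quotient.exact h
    have hiso' : (pairOf lam L).Iso (pairOf lam K) := Quotient.exact h.symm
    obtain rfl : K = L := le_antisymm (pairOf_le_of_iso hlow hiso) (pairOf_le_of_iso hlow hiso')
    obtain rfl : m = n := by
      have := hm.symm.trans hn
      exact_mod_cast this
    rfl
  have hsurj : Function.Surjective Φ := by
    intro x
    induction x using Quotient.inductionOn with
    | h p =>
      obtain ⟨p, hp⟩ := p
      obtain ⟨Q, hQ, e, he⟩ := exists_pairOf_iso hlow hI hp
      obtain ⟨m, hm⟩ := ENat.ne_top_iff_exists.1 (length_torsion_zero_ne_top Q)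
      refine ⟨⟨m, Q, hQ, hm.symm⟩, Quotient.sound ⟨e.symm, ?_⟩⟩
      exact (LinearEquiv.symm_apply_eq e).2 he.symm
  exact ⟨Equiv.ofBijective Φ ⟨hinj, hsurj⟩, fun m q => ⟨hpt m q, rfl⟩⟩

end Pairs

end SurfacePairs

theorem theorem1p3 (I : Ideal R4) [IsTorusFixed I]
    (hdim : ringKrullDim (R4 ⧸ I) = 2) (hT0 : torsion 0 (R4 ⧸ I) = ⊥) :
    (∃! lam : CoordPair → Set (ℕ × ℕ), IsPureData I lam) ∧
    (Function.Injective (LimHom.map I (torsion 1 (R4 ⧸ I)).subtype) ∧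
      Function.Exact (LimHom.map I (torsion 1 (R4 ⧸ I)).subtype)
        (LimHom.map I (torsion 1 (R4 ⧸ I)).mkQ) ∧
      Function.Surjective (LimHom.map I (torsion 1 (R4 ⧸ I)).mkQ)) ∧
    ∀ lam : CoordPair → Set (ℕ × ℕ), IsPureData I lam →
      (Function.Injective (LimHom.canonical I (PureSheaf I)) ∧
        EquivariantlyIso (LimQuot I (PureSheaf I)) (TorsionW lam)) ∧
      (torsion 1 (R4 ⧸ I) = ⊥ →
        Finite (Σ m : ℕ, FixedQuot (TorsionW lam) m) ∧
        ∃ Φ : (Σ m : ℕ, FixedQuot (TorsionW lam) m) ≃ FixedPT0 I,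
          ∀ (m : ℕ) (q : FixedQuot (TorsionW lam) m),
            ∃ h : (pairOf lam q.kernel).IsFixedPT0On I, Φ ⟨m, q⟩ = FixedPT0.mk _ h) := by
  refine ⟨existsUnique_isPureData hdim.le,
    ⟨LimHom.map_injective (Submodule.subtype_injective _), LimHom.map_exact _,
      map_mkQ_torsion_one_surjective hT0⟩, fun lam hlam =>
    ⟨⟨LimHom.canonical_injective (originTorsionFree_pureSheaf I), limQuot_equivariantlyIso hlam⟩,
      fun hT1 => ⟨finite_fixedQuot _, exists_equiv_fixedPT0 hdim (fun p => (hlam.1 p).2) ?_⟩⟩⟩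
  rw [← unionIdeal_univ, ← hlam.2, pureIdeal, hT1]
  exact (Submodule.ker_mkQ I).symm
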